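/- **Theorem 5.1.** Let $d\ge 1$. For $\tau\in\mathbb{R}^d$ let $\varepsilon_\tau\in L_2([-\pi,\pi]^d)$ be the function $\varepsilon_\tau(x)=(2\pi)^{-d/2}e^{i\langle x,\tau\rangle}$, and for $\ell\ge 1$ put $C_{\ell,d}=\{-\ell,\ldots,\ell\}^d\subset\mathbb{Z}^d$. Let $(t_n)_{n\in\mathbb{Z}^d}\subset\mathbb{R}^d$ be such that $(\varepsilon_{t_n})_{n\in\mathbb{Z}^d}$ is a uniformly invertible Riesz basis of $L_2([-\pi,\pi]^d)$, that is: $(\varepsilon_{t_n})_n$ is a Riesz basis (the image of an orthonormal basis under an isomorphism of the space onto itself), and, with $L$ the isomorphism of $L_2([-\pi,\pi]^d)$ onto itself determined by $L\varepsilon_n=\varepsilon_{t_n}$ for $n\in\mathbb{Z}^d$, the finite matrices $M_\ell=\big(\langle L\varepsilon_n,\varepsilon_m\rangle\big)_{m,n\in C_{\ell,d}}$ are invertible for all $\ell\ge1$ and $\sup_{\ell\ge 1}\|M_\ell^{-1}\|<\infty$ (operator norm for the Euclidean norm on $\mathbb{C}^{C_{\ell,d}}$). Let $PW_{[-\pi,\pi]^d}$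 be the space of the $f\in L_2(\mathbb{R}^d)$ whose $L_2$ inverse Fourier transform $\mathcal{F}^{-1}f(x)=(2\pi)^{-d/2}\int_{\mathbb{R}^d}f(\xi)e^{i\langle x,\xi\rangle}\,d\xi$ is supported in $[-\pi,\pi]^d$, each represented by its continuous version, and let $f\in PW_{[-\pi,\pi]^d}$. Then for every $\ell\ge 1$ there is a unique polynomial $\Psi_\ell$ in $d$ variables with complex coefficients, of degree at most $2\ell$ in each variable, such that $\Psi_\ell(t_n)=f(t_n)$ for all $n\in C_{\ell,d}$. Moreover, for every integer $N\ge0$ and every real $A>0$, with $$E_{\ell,N,A}=\Big[-A(\ell+\tfrac12)^{\frac{2N+1}{2N+2}},\,A(\ell+\tfrac12)^{\frac{2N+1}{2N+2}}\Big],\qquad I_{f,\ell}(t)=\Psi_\ell(t)\exp\Big(-\sum_{k=1}^N \frac{1}{k(2k-1)}\frac{\|t\|_{2k}^{2k}}{(\ell+\frac12)^{2k-1}}\Big),$$ where $\|t\|_{2k}^{2k}=\sum_{i=1}^d|t(i)|^{2k}$, we have $$\lim_{\ell\to\infty}\big\|f-I_{f,\ell}\big\|_{L_2((E_{\ell,N,A})^d)}=0\qquad\text{and}\qquad\lim_{\ell\to\infty}\big\|f-I_{f,\ell}\big\|_{L_\infty((E_{\ell,N,A})^d)}=0.$$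 -/

import Mathlib

open MeasureTheory Filter
open scoped ENNReal Topology FourierTransform

noncomputable section

namespace BandlimitedInterpolation

/-- Euclidean space `ℝ^d`. -/
abbrev E (d : ℕ) : Type := EuclideanSpace ℝ (Fin d)

/-- The closed cube `[-r, r]^d` in `ℝ^d`. -/
def cube (d : ℕ) (r : ℝ) : Set (E d) := {x | ∀ i, x i ∈ Set.Icc (-r) r}

/-- The measure of `[-π, π]^d`: Lebesgue measure restricted to this cube. -/
def cubeMeasure (d : ℕ) : Measure (E d) := volume.restrict (cube d Real.pi)

theorem volume_cube_lt_top (d : ℕ) (r : ℝ) : volume (cube d r) < ⊤ := by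
  refine Bornology.IsBounded.measure_lt_top ?_
  have h : cube d r ⊆ (EuclideanSpace.equiv (Fin d) ℝ).symm ''
      (Set.pi Set.univ fun _ : Fin d => Set.Icc (-r) r) := by
    intro x hx
    exact ⟨EuclideanSpace.equiv (Fin d) ℝ x, fun i _ => hx i, by simp⟩
  exact ((isCompact_univ_pi fun _ : Fin d => isCompact_Icc).image
    (EuclideanSpace.equiv (Fin d) ℝ).symm.continuous).isBounded.subset h

instance (d : ℕ) : IsFiniteMeasure (cubeMeasure d) :=
  ⟨by simpa [cubeMeasure] using volume_cube_lt_top d Real.pi⟩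

/-- The complex Hilbert space `L_2([-π, π]^d)`. -/
abbrev L2Cube (d : ℕ) : Type := Lp ℂ 2 (cubeMeasure d)

/-- The function `x ↦ (2π)^{-d/2} e^{i⟨x, τ⟩}` on `ℝ^d`. -/
def expFun (d : ℕ) (τ : E d) (x : E d) : ℂ :=
  (((2 * Real.pi) ^ (-(d : ℝ) / 2) : ℝ) : ℂ) * Complex.exp (Complex.I * ((inner ℝ x τ : ℝ) : ℂ))

theorem memLp_expFun (d : ℕ) (τ : E d) : MemLp (expFun d τ) 2 (cubeMeasure d) := by
  refine MemLp.of_bound (C := |(2 * Real.pi) ^ (-(d : ℝ) / 2)|) ?_ (Eventually.of_forall ?_)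
  · refine Continuous.aestronglyMeasurable ?_
    unfold expFun
    fun_prop
  · intro x
    rw [expFun, norm_mul, mul_comm Complex.I, Complex.norm_exp_ofReal_mul_I, mul_one,
      Complex.norm_real, Real.norm_eq_abs]

/-- The normalized exponential with frequency `τ`, as an element of `L_2([-π, π]^d)`. -/
def expL2 (d : ℕ) (τ : E d) : L2Cube d := (memLp_expFun d τ).toLp (expFun d τ)

/-- An integer vector as a point of `ℝ^d`. -/
def latticePoint (d : ℕ) (n : Fin d → ℤ) : E d := WithLp.toLp 2 fun i => (n i : ℝ)

/-- The finite index set `{-ℓ, …, ℓ}^d`. -/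
def indexCube (d ℓ : ℕ) : Finset (Fin d → ℤ) :=
  Fintype.piFinset fun _ => Finset.Icc (-(ℓ : ℤ)) (ℓ : ℤ)

section RieszBases

variable {ι H : Type*} [NormedAddCommGroup H] [InnerProductSpace ℂ H] [CompleteSpace H]

/-- A Riesz basis: the image of an orthonormal (Hilbert) basis under an isomorphism of `H`
onto itself. -/
def IsRieszBasis (v : ι → H) : Prop :=
  ∃ (b : HilbertBasis ι ℂ H) (L : H ≃L[ℂ] H), ∀ n, L (b n) = v n

/-- The finite matrix of `P L P` with respect to the orthonormal vectors `e n`, `n ∈ S`, where `P`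
is the orthogonal projection onto their span. -/
def sectionMatrix (e : ι → H) (L : H →L[ℂ] H) (S : Finset ι) : Matrix S S ℂ :=
  Matrix.of fun m n => inner ℂ (e m) (L (e n))

/-- `L` is uniformly invertible with respect to the projections onto `span {e n | n ∈ S ℓ}`,
`ℓ = 1, 2, …`: all the finite matrices are invertible, and the (Euclidean operator) norms of their
inverses are bounded. -/
def IsUniformlyInvertible [DecidableEq ι] (e : ι → H) (S : ℕ → Finset ι) (L : H →L[ℂ] H) :
    Prop :=
  ∃ M : ℝ, ∀ ℓ : ℕ, 1 ≤ ℓ → IsUnit (sectionMatrix e L (S ℓ)) ∧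
    ‖Matrix.toEuclideanCLM (n := S ℓ) (𝕜 := ℂ) (sectionMatrix e L (S ℓ))⁻¹‖ ≤ M

/-- `v` is a Riesz basis and the isomorphism `L` with `L (e n) = v n` is uniformly invertible with
respect to the projections onto `span {e n | n ∈ S ℓ}` (here `e` is an orthonormal basis). -/
def IsUniformlyInvertibleRieszBasis [DecidableEq ι] (e : ι → H) (S : ℕ → Finset ι) (v : ι → H) :
    Prop :=
  IsRieszBasis v ∧
    ∃ L : H ≃L[ℂ] H, (∀ n, L (e n) = v n) ∧ IsUniformlyInvertible e S (L : H →L[ℂ] H)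

end RieszBases

/-- The `L_2`-isometric inverse Fourier transform
`(F⁻¹ f)(x) = (2π)^{-d/2} ∫ f(ξ) e^{i⟨x, ξ⟩} dξ` on `L_2(ℝ^d)`. Mathlib's `𝓕⁻` has the kernel
`e^{2πi⟨x, ξ⟩}` and no factor in front, whence the rescaling. The result is meant up to
equality almost everywhere. -/
def invFourier (d : ℕ) (f : Lp ℂ 2 (volume : Measure (E d))) (x : E d) : ℂ :=
  (((2 * Real.pi) ^ (-(d : ℝ) / 2) : ℝ) : ℂ) *
    (𝓕⁻ f : Lp ℂ 2 (volume : Measure (E d))) ((2 * Real.pi)⁻¹ • x)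

/-- The Paley-Wiener space of `[-π, π]^d`: the functions in `L_2(ℝ^d)` whose inverse Fourier
transform vanishes almost everywhere outside `[-π, π]^d`; each class is represented by its
continuous member (which is unique). -/
def PaleyWiener (d : ℕ) : Set (E d → ℂ) :=
  {f | Continuous f ∧ ∃ hf : MemLp f 2 (volume : Measure (E d)),
    ∀ᵐ x ∂(volume : Measure (E d)), x ∉ cube d Real.pi → invFourier d (hf.toLp f) x = 0}

/-- The value at `x ∈ ℝ^d` of a polynomial with complex coefficients. -/
def polyEval {d : ℕ} (p : MvPolynomial (Fin d) ℂ) (x : E d) : ℂ :=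
  MvPolynomial.eval (fun i => ((x i : ℝ) : ℂ)) p

/-- `p` has degree at most `2ℓ` in each coordinate and interpolates `f` at the nodes `t n`,
`n ∈ {-ℓ, …, ℓ}^d`. -/
def IsInterpolant {d : ℕ} (t : (Fin d → ℤ) → E d) (f : E d → ℂ) (ℓ : ℕ)
    (p : MvPolynomial (Fin d) ℂ) : Prop :=
  (∀ i, p.degreeOf i ≤ 2 * ℓ) ∧ ∀ n ∈ indexCube d ℓ, polyEval p (t n) = f (t n)

/-- The multiplier `exp (-∑_{k=1}^N ‖x‖_{2k}^{2k} / (k (2k-1) (ℓ+1/2)^{2k-1}))`. -/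
def multiplier {d : ℕ} (N ℓ : ℕ) (x : E d) : ℝ :=
  Real.exp (-∑ k ∈ Finset.Icc 1 N,
    1 / ((k : ℝ) * (2 * (k : ℝ) - 1)) *
      ((∑ i, |x i| ^ (2 * k)) / ((ℓ : ℝ) + 1 / 2) ^ (2 * k - 1)))

/-- The half side length `A (ℓ+1/2)^{(2N+1)/(2N+2)}` of the growing cubes. -/
def halfSide (N : ℕ) (A : ℝ) (ℓ : ℕ) : ℝ :=
  A * ((ℓ : ℝ) + 1 / 2) ^ ((2 * (N : ℝ) + 1) / (2 * (N : ℝ) + 2))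

end BandlimitedInterpolation

end

namespace BandlimitedInterpolation

/-! ### Tails of the sine product -/

/-! Write `f = bandlimited g`, that is f(x) = ⟨ε_x, g⟩ with g ∈ L_2([-π,π]^d), and let Q_ℓ(x) = ∏_i
∏_{k>ℓ} (1 - x_i²/k²) (`cubeSineTail`). If a polynomial p has degree at most 2ℓ in each variable,
then p·Q_ℓ is a combination of the products of cardinal sines centred at the lattice points of C_ℓ
(`exists_bandlimited_eq_polyEval_mul`). Hence Ψ_ℓ Q_ℓ = `bandlimited G_ℓ` with G_ℓ in the span of
ε_n, n ∈ C_ℓ, and interpolation at t_n becomes the finite system ⟨Lε_n, G_ℓ⟩ = Q_ℓ(t_n) ⟨Lε_n, g⟩.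

Its matrix is the adjoint of the section of L, so invertibility gives uniqueness, and counting
dimensions gives existence (`existsUnique_isInterpolant`). Since |Q_ℓ| ≤ 1 and Q_ℓ(t_n) → 1 for each
n, the uniform bound on the inverses gives G_ℓ → g (`tendsto_of_isUniformlyInvertible`).

With m the multiplier, f - Ψ_ℓ m = (m/Q_ℓ)(f - Ψ_ℓ Q_ℓ) - f (m/Q_ℓ - 1). Expanding log(1 - x²/k²)
and estimating ∑_{k>ℓ} k^{-2j} ≤ 1/((2j-1)(ℓ+1/2)^{2j-1}) bounds m/Q_ℓ on the growing cubes
(`ratio_le_of_mem_cube_halfSide`); on fixed cubes m/Q_ℓ → 1 uniformly. The first term is then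
controlled by ‖g - G_ℓ‖ in both norms. The second vanishes by dominated convergence in L_2, and by
the decay of f at infinity in L_∞. -/

theorem two_mul_pow_le_add_pow_and_sub_pow {k h : ℝ} (hh : 0 ≤ h) (hk : h ≤ k) (p : ℕ) :
    2 * k ^ p ≤ (k + h) ^ p + (k - h) ^ p ∧
      2 * h * p * k ^ p ≤ k * ((k + h) ^ p - (k - h) ^ p) := by
  have k0 : 0 ≤ k := hh.trans hk
  -- The bounds are proved together because the induction step of the second uses the first.
  induction p with
  | zero => norm_num
  | succ p ih =>
    obtain ⟨h1, h2⟩ := ih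
    have h3 : 0 ≤ (k + h) ^ p - (k - h) ^ p :=
      sub_nonneg.2 (pow_le_pow_left₀ (by linarith) (by linarith) p)
    have h4 := mul_le_mul_of_nonneg_left h1 k0
    have h5 := mul_le_mul_of_nonneg_left h1 (mul_nonneg hh k0)
    have h6 := mul_le_mul_of_nonneg_left h2 k0
    have h7 := mul_nonneg hh h3
    push_cast
    constructor
    · ring_nf at *; linarith
    · ring_nf at *; linarith

/-- The midpoint inequality for `x ↦ x ^ (-(p + 1))` on an interval of length one. -/
theorem midpoint_inv_pow_le {k : ℝ} (hk : 1 / 2 < k) {p : ℕ} (hp : 1 ≤ p) :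
    1 / k ^ (p + 1) ≤ 1 / (p * (k - 1 / 2) ^ p) - 1 / (p * (k + 1 / 2) ^ p) := by
  have k0 : 0 < k := by linarith
  have p0 : (0 : ℝ) < p := by exact_mod_cast hp
  have ha : 0 < (k - 1 / 2) ^ p := pow_pos (by linarith) p
  have hb : 0 < (k + 1 / 2) ^ p := pow_pos (by linarith) p
  have h2 := (two_mul_pow_le_add_pow_and_sub_pow (by norm_num : (0 : ℝ) ≤ 1 / 2) hk.le p).2
  have h3 : (k - 1 / 2) ^ p * (k + 1 / 2) ^ p ≤ k ^ p * k ^ p := by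
    rw [← mul_pow, ← mul_pow]
    refine pow_le_pow_left₀ (mul_nonneg (by linarith) (by linarith)) ?_ p
    nlinarith
  have h4 : 1 / (p * (k - 1 / 2) ^ p) - 1 / (p * (k + 1 / 2) ^ p)
      = ((k + 1 / 2) ^ p - (k - 1 / 2) ^ p) / (p * ((k - 1 / 2) ^ p * (k + 1 / 2) ^ p)) := by
    have ha' := ha.ne'
    have hb' := hb.ne'
    generalize (k - 1 / 2) ^ p = a at *
    generalize (k + 1 / 2) ^ p = b at *
    field_simp
  rw [h4, div_le_div_iff₀ (by positivity) (by positivity)]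
  have kp : 0 < k ^ p := by positivity
  have h5 : p * ((k - 1 / 2) ^ p * (k + 1 / 2) ^ p) ≤ p * (k ^ p * k ^ p) := by gcongr
  calc 1 * (p * ((k - 1 / 2) ^ p * (k + 1 / 2) ^ p)) ≤ (p * k ^ p) * k ^ p := by linarith
    _ ≤ (k * ((k + 1 / 2) ^ p - (k - 1 / 2) ^ p)) * k ^ p := by
      exact mul_le_mul_of_nonneg_right (by linarith) kp.le
    _ = _ := by ring

/-- The midpoint inequality, applied on unit intervals centred at the integers, telescopes. This is
the source of ℓ + 1/2 and of the factors 2k - 1 in the multiplier. -/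
theorem sum_inv_pow_le (ℓ K : ℕ) {p : ℕ} (hp : 1 ≤ p) :
    ∑ k ∈ Finset.range K, 1 / ((ℓ : ℝ) + k + 1) ^ (p + 1) ≤ 1 / (p * ((ℓ : ℝ) + 1 / 2) ^ p) := by
  suffices ∑ k ∈ Finset.range K, 1 / ((ℓ : ℝ) + k + 1) ^ (p + 1)
      ≤ 1 / (p * ((ℓ : ℝ) + 1 / 2) ^ p) - 1 / (p * ((ℓ : ℝ) + K + 1 / 2) ^ p) from
    this.trans (sub_le_self _ (by positivity))
  induction K with
  | zero => simp
  | succ K ih =>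
    rw [Finset.sum_range_succ]
    have := midpoint_inv_pow_le (k := (ℓ : ℝ) + K + 1)
      (by have := Nat.cast_nonneg (α := ℝ) ℓ; have := Nat.cast_nonneg (α := ℝ) K; linarith) hp
    have e1 : (ℓ : ℝ) + K + 1 - 1 / 2 = ℓ + K + 1 / 2 := by ring
    have e2 : (ℓ : ℝ) + K + 1 + 1 / 2 = ℓ + (K + 1 : ℕ) + 1 / 2 := by push_cast; ring
    rw [e1, e2] at this
    linarith

/-- Taylor expansion of log(1 - y); its remainder is at most y^(N+1)/(1 - y), and 1/(1 - y) ≤ 2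
here. -/
theorem exp_neg_sum_le_one_sub {y : ℝ} (h0 : 0 ≤ y) (h1 : y ≤ 1 / 4) (N : ℕ) :
    Real.exp (-((∑ i ∈ Finset.range N, y ^ (i + 1) / (i + 1)) + 2 * y ^ (N + 1))) ≤ 1 - y := by
  have h := (abs_le.1 (Real.abs_log_sub_add_sum_range_le (x := y)
    (by rw [abs_of_nonneg h0]; linarith) N)).1
  rw [abs_of_nonneg h0] at h
  have h2 : y ^ (N + 1) / (1 - y) ≤ 2 * y ^ (N + 1) := by
    rw [div_le_iff₀ (by linarith)]
    nlinarith [pow_nonneg h0 (N + 1)]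
  rw [← Real.le_log_iff_exp_le (by linarith)]
  linarith

/-- The exponent in the lower bound for the tails of the sine product. -/
noncomputable def tailExponent (N ℓ : ℕ) (t : ℝ) : ℝ :=
  ∑ k ∈ Finset.Icc 1 N,
    1 / ((k : ℝ) * (2 * (k : ℝ) - 1)) * (|t| ^ (2 * k) / ((ℓ : ℝ) + 1 / 2) ^ (2 * k - 1))

/-- The condition on t makes every t²/k² at most 1/4, so the logarithm of each factor can be
expanded to order N. Summing over k first turns the powers of t²/k² into the terms of
`tailExponent`, and the remainder into the extra term. -/
theorem exp_neg_tailExponent_le_prod {ℓ : ℕ} (N K : ℕ) {t : ℝ}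
    (ht : |t| < ((ℓ : ℝ) + 1 / 2) / 2) :
    Real.exp (-(tailExponent N ℓ t + 2 * t ^ (2 * N + 2) / ((ℓ : ℝ) + 1 / 2) ^ (2 * N + 1))) ≤
      ∏ k ∈ Finset.range K, (1 - t ^ 2 / ((ℓ : ℝ) + k + 1) ^ 2) := by
  have hℓ : (0 : ℝ) ≤ ℓ := Nat.cast_nonneg ℓ
  have hy : ∀ k : ℕ, t ^ 2 / ((ℓ : ℝ) + k + 1) ^ 2 ≤ 1 / 4 := by
    intro k
    have hk : (0 : ℝ) ≤ k := Nat.cast_nonneg k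
    rw [div_le_iff₀ (by positivity), ← sq_abs t]
    have := abs_nonneg t
    nlinarith
  have hprod : Real.exp (∑ k ∈ Finset.range K,
      -((∑ i ∈ Finset.range N, (t ^ 2 / ((ℓ : ℝ) + k + 1) ^ 2) ^ (i + 1) / (i + 1)) +
        2 * (t ^ 2 / ((ℓ : ℝ) + k + 1) ^ 2) ^ (N + 1))) ≤
      ∏ k ∈ Finset.range K, (1 - t ^ 2 / ((ℓ : ℝ) + k + 1) ^ 2) := by
    rw [Real.exp_sum]
    exact Finset.prod_le_prod (fun _ _ => (Real.exp_pos _).le)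
      fun k _ => exp_neg_sum_le_one_sub (by positivity) (hy k) N
  refine le_trans (Real.exp_le_exp.2 ?_) hprod
  rw [Finset.sum_neg_distrib, neg_le_neg_iff, Finset.sum_add_distrib, Finset.sum_comm]
  have hpow : ∀ i : ℕ, ∑ k ∈ Finset.range K, (t ^ 2 / ((ℓ : ℝ) + k + 1) ^ 2) ^ (i + 1) ≤
      t ^ (2 * (i + 1)) * (1 / ((2 * i + 1) * ((ℓ : ℝ) + 1 / 2) ^ (2 * i + 1))) := by
    intro i
    have h := sum_inv_pow_le ℓ K (p := 2 * i + 1) (by omega)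
    push_cast at h
    refine le_trans (le_of_eq ?_) (mul_le_mul_of_nonneg_left h
      (by rw [pow_mul]; positivity : 0 ≤ t ^ (2 * (i + 1))))
    rw [Finset.mul_sum]
    refine Finset.sum_congr rfl fun k _ => ?_
    rw [div_pow, ← pow_mul, ← pow_mul]
    ring_nf
  refine add_le_add ?_ ?_
  · rw [tailExponent, ← Finset.Ico_add_one_right_eq_Icc, Finset.sum_Ico_eq_sum_range,
      add_tsub_cancel_right]
    refine Finset.sum_le_sum fun i _ => ?_
    rw [← Finset.sum_div]
    refine (div_le_div_of_nonneg_right (hpow i) (by positivity)).trans (le_of_eq ?_)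
    have e1 : 2 * (1 + i) - 1 = 2 * i + 1 := by omega
    rw [e1, pow_mul |t|, sq_abs, ← pow_mul, add_comm 1 i]
    push_cast
    have e2 : (2 : ℝ) * ((i : ℝ) + 1) - 1 = 2 * i + 1 := by ring
    rw [e2]
    field_simp
  · rw [← Finset.mul_sum]
    have h := hpow N
    have h2 : t ^ (2 * (N + 1)) * (1 / ((2 * N + 1) * ((ℓ : ℝ) + 1 / 2) ^ (2 * N + 1))) ≤
        t ^ (2 * N + 2) / ((ℓ : ℝ) + 1 / 2) ^ (2 * N + 1) := by
      rw [mul_one_div]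
      have : 0 ≤ t ^ (2 * (N + 1)) := by rw [pow_mul]; positivity
      refine div_le_div_of_nonneg_left this (by positivity) ?_
      refine le_mul_of_one_le_left (by positivity) ?_
      have := Nat.cast_nonneg (α := ℝ) N
      linarith
    calc _ ≤ 2 * _ := mul_le_mul_of_nonneg_left (h.trans h2) (by norm_num)
      _ = _ := by ring

theorem abs_prod_tail_le_one {ℓ : ℕ} (K : ℕ) {t : ℝ} (ht : t ^ 2 ≤ 2 * ((ℓ : ℝ) + 1) ^ 2) :
    |∏ k ∈ Finset.range K, (1 - t ^ 2 / ((ℓ : ℝ) + k + 1) ^ 2)| ≤ 1 := by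
  rw [Finset.abs_prod]
  refine Finset.prod_le_one (fun _ _ => abs_nonneg _) fun k _ => ?_
  have hℓ : (0 : ℝ) ≤ ℓ := Nat.cast_nonneg ℓ
  have hk : (0 : ℝ) ≤ k := Nat.cast_nonneg k
  have h0 : 0 ≤ t ^ 2 / ((ℓ : ℝ) + k + 1) ^ 2 := by positivity
  have h1 : t ^ 2 / ((ℓ : ℝ) + k + 1) ^ 2 ≤ 2 := by
    rw [div_le_iff₀ (by positivity)]
    nlinarith
  rw [abs_le]
  constructor <;> linarith

/-! ### The truncated sine product as a combination of shifted cardinal sines -/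

/-- The nodes `-ℓ, …, ℓ` on the line. -/
noncomputable def lineNodes (ℓ : ℕ) : Finset ℤ := Finset.Icc (-(ℓ : ℤ)) (ℓ : ℤ)

theorem card_lineNodes (ℓ : ℕ) : (lineNodes ℓ).card = 2 * ℓ + 1 := by
  rw [lineNodes, Int.card_Icc]
  omega

/-- The coefficients of `∏ k > ℓ, (1 - t² / k²)` with respect to the shifted cardinal sines. -/
noncomputable def sincCoeff (ℓ : ℕ) (n : ℤ) : ℝ :=
  (∏ k ∈ Finset.range ℓ, -((k : ℝ) + 1) ^ 2) * ((-1) ^ n *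
    Lagrange.nodalWeight (lineNodes ℓ) (fun m : ℤ => (m : ℝ)) n)

/-- The function `t ↦ ∏ k > ℓ, (1 - t² / k²)`. -/
noncomputable def sineTail (ℓ : ℕ) (t : ℝ) : ℝ :=
  ∑ n ∈ lineNodes ℓ, sincCoeff ℓ n * Real.sinc (Real.pi * (t - n))

theorem continuous_sineTail (ℓ : ℕ) : Continuous (sineTail ℓ) := by
  unfold sineTail
  have := Real.continuous_sinc
  fun_prop

theorem prod_lineNodes_sub (ℓ : ℕ) (t : ℝ) :
    ∏ n ∈ lineNodes ℓ, (t - n) = t * ∏ k ∈ Finset.range ℓ, (t ^ 2 - ((k : ℝ) + 1) ^ 2) := by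
  induction ℓ with
  | zero => simp [lineNodes]
  | succ ℓ ih =>
    have h : lineNodes (ℓ + 1) = insert (-((ℓ : ℤ) + 1)) (insert ((ℓ : ℤ) + 1) (lineNodes ℓ)) := by
      ext n
      simp only [lineNodes, Finset.mem_insert, Finset.mem_Icc]
      push_cast
      omega
    rw [h, Finset.prod_insert, Finset.prod_insert, ih, Finset.prod_range_succ]
    · push_cast
      ring
    · simp [lineNodes]
    · simp only [lineNodes, Finset.mem_insert, Finset.mem_Icc]
      omega

theorem dense_nonintegers : Dense {t : ℝ | ∀ n : ℤ, t ≠ n} := by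
  have h : {t : ℝ | ∀ n : ℤ, t ≠ n} = (Set.range fun n : ℤ => (n : ℝ))ᶜ := by
    ext t
    simp [eq_comm]
  rw [h]
  exact (Set.countable_range _).dense_compl ℝ

/-- Lagrange interpolation at the 2ℓ + 1 integer nodes reproduces t^a. In barycentric form it is a
sum of multiples of 1/(t - n), and sin(π(t - n)) = (-1)^n sin(πt) turns these into shifted cardinal
sines. -/
theorem pow_mul_sinc_sum_of_nonint {ℓ a : ℕ} (ha : a ≤ 2 * ℓ) {t : ℝ} (ht : ∀ n : ℤ, t ≠ n) :
    (∑ n ∈ lineNodes ℓ, (n : ℝ) ^ a * (sincCoeff ℓ n * Real.sinc (Real.pi * (t - n)))) *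
      (Real.pi * t * ∏ k ∈ Finset.range ℓ, (1 - t ^ 2 / ((k : ℝ) + 1) ^ 2)) =
      t ^ a * Real.sin (Real.pi * t) := by
  have hinj : Set.InjOn (fun m : ℤ => (m : ℝ)) (lineNodes ℓ) := Int.cast_injective.injOn
  have hpoly : (Polynomial.X ^ a : Polynomial ℝ) =
      Lagrange.interpolate (lineNodes ℓ) (fun m : ℤ => (m : ℝ)) fun n => (n : ℝ) ^ a := by
    refine Lagrange.eq_interpolate_of_eval_eq _ hinj ?_ fun i _ => by simp
    rw [Polynomial.degree_X_pow, card_lineNodes]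
    exact_mod_cast Nat.lt_succ_of_le ha
  have hl := congrArg (Polynomial.eval t) hpoly
  rw [Lagrange.eval_interpolate_not_at_node _ fun i _ => ht i, Polynomial.eval_pow,
    Polynomial.eval_X, Lagrange.eval_nodal, prod_lineNodes_sub] at hl
  -- Normalizing the factors of the nodal polynomial to the value 1 at 0 produces the constant in
  -- `sincCoeff`.
  have hκ : ∏ k ∈ Finset.range ℓ, (t ^ 2 - ((k : ℝ) + 1) ^ 2) =
      (∏ k ∈ Finset.range ℓ, -((k : ℝ) + 1) ^ 2) *
        ∏ k ∈ Finset.range ℓ, (1 - t ^ 2 / ((k : ℝ) + 1) ^ 2) := by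
    rw [← Finset.prod_mul_distrib]
    refine Finset.prod_congr rfl fun k _ => ?_
    have : (k : ℝ) + 1 ≠ 0 := by positivity
    field_simp
    ring
  have hterm : ∀ n : ℤ, (n : ℝ) ^ a * (sincCoeff ℓ n * Real.sinc (Real.pi * (t - n))) =
      (∏ k ∈ Finset.range ℓ, -((k : ℝ) + 1) ^ 2) * (Real.sin (Real.pi * t) / Real.pi) *
        (Lagrange.nodalWeight (lineNodes ℓ) (fun m : ℤ => (m : ℝ)) n * (t - n)⁻¹ *
          (n : ℝ) ^ a) := by
    intro n
    have h1 : t - n ≠ 0 := sub_ne_zero.2 (ht n)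
    have h2 : Real.pi ≠ 0 := Real.pi_ne_zero
    rw [Real.sinc_of_ne_zero (mul_ne_zero h2 h1), mul_sub, mul_comm Real.pi (n : ℝ),
      Real.sin_sub_int_mul_pi, sincCoeff]
    have h3 : ((-1 : ℝ) ^ n) * (-1) ^ n = 1 := by
      rw [← mul_zpow]; simp
    have h4 : Real.pi * t - n * Real.pi = Real.pi * (t - n) := by ring
    rw [h4]
    field_simp
    linear_combination (n : ℝ) ^ a * (∏ k ∈ Finset.range ℓ, -((k : ℝ) + 1) ^ 2) *
      Lagrange.nodalWeight (lineNodes ℓ) (fun m : ℤ => (m : ℝ)) n * Real.sin (Real.pi * t) * h3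
  simp_rw [hterm]
  rw [← Finset.mul_sum]
  rw [hκ] at hl
  rw [hl]
  have h2 : Real.pi ≠ 0 := Real.pi_ne_zero
  field_simp

theorem sineTail_mul_of_nonint (ℓ : ℕ) {t : ℝ} (ht : ∀ n : ℤ, t ≠ n) :
    sineTail ℓ t * (Real.pi * t * ∏ k ∈ Finset.range ℓ, (1 - t ^ 2 / ((k : ℝ) + 1) ^ 2)) =
      Real.sin (Real.pi * t) := by
  have h := pow_mul_sinc_sum_of_nonint (Nat.zero_le (2 * ℓ)) ht
  simpa [sineTail] using h

theorem sine_factor_ne_zero (ℓ : ℕ) {t : ℝ} (ht : ∀ n : ℤ, t ≠ n) :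
    Real.pi * t * ∏ k ∈ Finset.range ℓ, (1 - t ^ 2 / ((k : ℝ) + 1) ^ 2) ≠ 0 := by
  refine mul_ne_zero (mul_ne_zero Real.pi_ne_zero (by simpa using ht 0))
    (Finset.prod_ne_zero_iff.2 fun k _ h => ?_)
  have hk : (k : ℝ) + 1 ≠ 0 := by positivity
  rw [sub_eq_zero, eq_div_iff (pow_ne_zero 2 hk), one_mul, eq_comm, sq_eq_sq_iff_eq_or_eq_neg] at h
  rcases h with h | h
  · exact ht (k + 1) (by push_cast; exact h)
  · exact ht (-(k + 1)) (by push_cast; linarith)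

/-- Off the integers both sides agree after multiplication by the same nonzero factor; density and
continuity give the rest. Thus multiplication by t^a only rescales the sinc coefficients by the
nodal values n^a. -/
theorem pow_mul_sineTail {ℓ a : ℕ} (ha : a ≤ 2 * ℓ) (t : ℝ) :
    t ^ a * sineTail ℓ t =
      ∑ n ∈ lineNodes ℓ, (n : ℝ) ^ a * (sincCoeff ℓ n * Real.sinc (Real.pi * (t - n))) := by
  have hs := Real.continuous_sinc
  have hc := continuous_sineTail ℓ
  refine congrFun (Continuous.ext_on dense_nonintegers
    (f := fun t => t ^ a * sineTail ℓ t)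
    (g := fun t => ∑ n ∈ lineNodes ℓ,
      (n : ℝ) ^ a * (sincCoeff ℓ n * Real.sinc (Real.pi * (t - n))))
    (by fun_prop) (by fun_prop) ?_) t
  intro t ht
  refine mul_right_cancel₀ (sine_factor_ne_zero ℓ ht) ?_
  rw [pow_mul_sinc_sum_of_nonint ha ht, mul_assoc, sineTail_mul_of_nonint ℓ ht]

/-- Euler's product for the sine, divided by its first ℓ factors, identifies the finite sinc sum
with the infinite tail product. -/
theorem tendsto_prod_sineTail (ℓ : ℕ) {t : ℝ} (ht : ∀ n : ℤ, t ≠ n) :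
    Tendsto (fun K : ℕ => ∏ k ∈ Finset.range K, (1 - t ^ 2 / ((ℓ : ℝ) + k + 1) ^ 2)) atTop
      (𝓝 (sineTail ℓ t)) := by
  have h0 := sine_factor_ne_zero ℓ ht
  have h := (Real.tendsto_euler_sin_prod t).comp (tendsto_add_atTop_nat ℓ)
  have h' := h.div_const (Real.pi * t * ∏ k ∈ Finset.range ℓ, (1 - t ^ 2 / ((k : ℝ) + 1) ^ 2))
  rw [← sineTail_mul_of_nonint ℓ ht, mul_div_cancel_right₀ _ h0] at h'
  refine h'.congr fun K => ?_
  simp only [Function.comp]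
  rw [add_comm K ℓ, Finset.prod_range_add, ← mul_assoc, mul_div_cancel_left₀ _ h0]
  refine Finset.prod_congr rfl fun k _ => ?_
  push_cast
  rfl

/-- For t² ≤ 2(ℓ+1)² every factor of the tail lies in [-1, 1]. For larger t the tail is sin(πt)
divided by πt and the first ℓ factors, all of absolute value at least 1. -/
theorem abs_sineTail_le_one (ℓ : ℕ) (t : ℝ) : |sineTail ℓ t| ≤ 1 := by
  have hcl : IsClosed {t : ℝ | |sineTail ℓ t| ≤ 1} :=
    isClosed_le (continuous_sineTail ℓ).abs continuous_const
  suffices h : {t : ℝ | ∀ n : ℤ, t ≠ n} ⊆ {t : ℝ | |sineTail ℓ t| ≤ 1} from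
    closure_minimal h hcl (dense_nonintegers t)
  intro t ht
  rw [Set.mem_ofPred_eq]
  rcases le_total (t ^ 2) (2 * ((ℓ : ℝ) + 1) ^ 2) with h | h
  · exact le_of_tendsto (tendsto_prod_sineTail ℓ ht).abs
      (Eventually.of_forall fun K => abs_prod_tail_le_one K h)
  · have h1 := congrArg abs (sineTail_mul_of_nonint ℓ ht)
    have hℓ : (0 : ℝ) ≤ ℓ := Nat.cast_nonneg ℓ
    have h2 : 1 ≤ |Real.pi * t * ∏ k ∈ Finset.range ℓ, (1 - t ^ 2 / ((k : ℝ) + 1) ^ 2)| := by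
      rw [abs_mul, Finset.abs_prod]
      refine one_le_mul_of_one_le_of_one_le ?_ ?_
      · rw [abs_mul, abs_of_pos Real.pi_pos]
        refine one_le_mul_of_one_le_of_one_le (by linarith [Real.pi_gt_three]) ?_
        rw [← one_le_sq_iff_one_le_abs]
        nlinarith
      · suffices h2 : ∏ k ∈ Finset.range ℓ, (1 : ℝ) ≤
            ∏ k ∈ Finset.range ℓ, |1 - t ^ 2 / ((k : ℝ) + 1) ^ 2| by simpa using h2
        refine Finset.prod_le_prod (fun _ _ => zero_le_one) fun k hk => ?_
        have hk' : (k : ℝ) + 1 ≤ ℓ := by exact_mod_cast Finset.mem_range.1 hk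
        have hk0 : (0 : ℝ) ≤ k := Nat.cast_nonneg k
        have h3 : 2 ≤ t ^ 2 / ((k : ℝ) + 1) ^ 2 := by
          rw [le_div_iff₀ (by positivity)]
          nlinarith
        rw [abs_of_nonpos (by linarith)]
        linarith
    rw [abs_mul] at h1
    have h3 := Real.abs_sin_le_one (Real.pi * t)
    nlinarith [abs_nonneg (sineTail ℓ t)]

theorem exp_neg_tailExponent_le_sineTail {ℓ : ℕ} (N : ℕ) {t : ℝ}
    (ht : |t| < ((ℓ : ℝ) + 1 / 2) / 2) :
    Real.exp (-(tailExponent N ℓ t + 2 * t ^ (2 * N + 2) / ((ℓ : ℝ) + 1 / 2) ^ (2 * N + 1))) ≤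
      sineTail ℓ t := by
  have hU : IsOpen {t : ℝ | |t| < ((ℓ : ℝ) + 1 / 2) / 2} :=
    isOpen_lt continuous_abs continuous_const
  have hcl : IsClosed {t : ℝ | Real.exp (-(tailExponent N ℓ t +
      2 * t ^ (2 * N + 2) / ((ℓ : ℝ) + 1 / 2) ^ (2 * N + 1))) ≤ sineTail ℓ t} := by
    refine isClosed_le ?_ (continuous_sineTail ℓ)
    unfold tailExponent
    fun_prop
  refine closure_minimal ?_ hcl (dense_nonintegers.open_subset_closure_inter hU ht)
  rintro s ⟨hs, hs'⟩
  exact ge_of_tendsto (tendsto_prod_sineTail ℓ hs')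
    (Eventually.of_forall fun K => exp_neg_tailExponent_le_prod N K hs)

theorem sineTail_pos {ℓ : ℕ} {t : ℝ} (ht : |t| < ((ℓ : ℝ) + 1 / 2) / 2) : 0 < sineTail ℓ t :=
  (Real.exp_pos _).trans_le (exp_neg_tailExponent_le_sineTail 0 ht)

/-! ### Uniformly invertible operators and finite sections -/

section FiniteSections

variable {ι H : Type*} [NormedAddCommGroup H] [InnerProductSpace ℂ H]

/-- An inverse and its adjoint have equal norms. The adjoint matters because the interpolation
conditions pair L(e n) with the unknown vector. -/
theorem norm_le_mul_norm_conjTranspose {n : Type*} [Fintype n] [DecidableEq n]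
    {A : Matrix n n ℂ} (hA : IsUnit A) {K : ℝ}
    (hK : ‖Matrix.toEuclideanCLM (n := n) (𝕜 := ℂ) A⁻¹‖ ≤ K) (x : EuclideanSpace ℂ n) :
    ‖x‖ ≤ K * ‖Matrix.toEuclideanCLM (n := n) (𝕜 := ℂ) (star A) x‖ := by
  have h1 : star A⁻¹ * star A = 1 := by
    rw [← star_mul, Matrix.mul_nonsing_inv _ ((Matrix.isUnit_iff_isUnit_det A).1 hA), star_one]
  have h2 : x = Matrix.toEuclideanCLM (n := n) (𝕜 := ℂ) (star A⁻¹)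
      (Matrix.toEuclideanCLM (n := n) (𝕜 := ℂ) (star A) x) := by
    rw [← mul_apply_eq_comp, ← map_mul, h1, map_one, one_apply_eq_self]
  calc ‖x‖ = _ := congrArg norm h2
    _ ≤ _ := ContinuousLinearMap.le_opNorm _ _
    _ ≤ _ := by
      rw [map_star, ContinuousLinearMap.star_eq_adjoint, LinearIsometryEquiv.norm_map]
      gcongr

theorem norm_sq_sum_smul_of_orthonormal {e : ι → H} (he : Orthonormal ℂ e) (S : Finset ι)
    (x : ι → ℂ) : ‖∑ m ∈ S, x m • e m‖ ^ 2 = ∑ m ∈ S, ‖x m‖ ^ 2 := by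
  have h := he.inner_sum x x S
  rw [inner_self_eq_norm_sq_to_K] at h
  have h2 : ∀ m, (starRingEnd ℂ) (x m) * x m = ((‖x m‖ ^ 2 : ℝ) : ℂ) := fun m => by
    rw [mul_comm, Complex.mul_conj, Complex.normSq_eq_norm_sq]
  simp_rw [h2] at h
  rw [← Complex.ofReal_inj]
  push_cast at h ⊢
  exact h

/-- Stability of the finite system: the adjoint section sends the coefficients x to the numbers ⟨L(e
n), ∑ x m • e m⟩. Used with zero data for uniqueness, and with a bound uniform in ℓ for convergence.
-/
theorem norm_sq_le_of_sectionMatrix [DecidableEq ι] {e : ι → H} (he : Orthonormal ℂ e)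
    {L : H →L[ℂ] H} {S : Finset ι} (hS : IsUnit (sectionMatrix e L S)) {K : ℝ}
    (hK : ‖Matrix.toEuclideanCLM (n := S) (𝕜 := ℂ) (sectionMatrix e L S)⁻¹‖ ≤ K) (x : ι → ℂ) :
    ‖∑ m ∈ S, x m • e m‖ ^ 2 ≤
      K ^ 2 * ∑ n ∈ S, ‖inner ℂ (L (e n)) (∑ m ∈ S, x m • e m)‖ ^ 2 := by
  set y : EuclideanSpace ℂ S := WithLp.toLp 2 fun m : S => x m with hy
  have h := norm_le_mul_norm_conjTranspose hS hK y
  have hn : ‖y‖ ^ 2 = ‖∑ m ∈ S, x m • e m‖ ^ 2 := by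
    rw [norm_sq_sum_smul_of_orthonormal he, EuclideanSpace.norm_sq_eq, ← Finset.sum_coe_sort S]
  have hA : ‖Matrix.toEuclideanCLM (n := S) (𝕜 := ℂ) (star (sectionMatrix e L S)) y‖ ^ 2 =
      ∑ n ∈ S, ‖inner ℂ (L (e n)) (∑ m ∈ S, x m • e m)‖ ^ 2 := by
    rw [EuclideanSpace.norm_sq_eq, ← Finset.sum_coe_sort S]
    refine Finset.sum_congr rfl fun n _ => ?_
    rw [hy, Matrix.toEuclideanCLM_toLp, inner_sum, ← Finset.sum_coe_sort S]
    congr 2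
    simp only [Matrix.mulVec, dotProduct]
    refine Finset.sum_congr rfl fun m _ => ?_
    rw [inner_smul_right, Matrix.star_apply, sectionMatrix, Matrix.of_apply, mul_comm]
    congr 1
    exact inner_conj_symm _ _
  rw [← hn, ← hA, ← mul_pow]
  exact pow_le_pow_left₀ (norm_nonneg _) h 2

/-- If v = L' b for a Hilbert basis b, then e = L⁻¹ L' b, and an isomorphism preserves density of
the span. Completeness of the trigonometric system is thus drawn from the Riesz basis hypothesis. -/
theorem hilbertBasis_of_isRieszBasis [CompleteSpace H] {e v : ι → H} (he : Orthonormal ℂ e)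
    (hv : IsRieszBasis v) (L : H ≃L[ℂ] H) (hL : ∀ n, L (e n) = v n) :
    ∃ b : HilbertBasis ι ℂ H, ⇑b = e := by
  obtain ⟨b, L', hb⟩ := hv
  have hT : ∀ n, (L'.trans L.symm) (b n) = e n := fun n => by
    rw [ContinuousLinearEquiv.trans_apply, hb, ← hL, L.symm_apply_apply]
  have hd : Dense ((Submodule.span ℂ (Set.range e) : Submodule ℂ H) : Set H) := by
    have h1 : Dense ((Submodule.span ℂ (Set.range b) : Submodule ℂ H) : Set H) :=
      (Submodule.dense_iff_topologicalClosure_eq_top).2 b.dense_span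
    have h2 := (L'.trans L.symm).surjective.denseRange.dense_image
      (L'.trans L.symm).continuous h1
    convert! h2 using 1
    have h3 : Set.range e = (L'.trans L.symm : H →ₗ[ℂ] H) '' Set.range b := by
      rw [← Set.range_comp]
      exact congrArg Set.range (funext fun n => (hT n).symm)
    rw [h3, ← Submodule.map_span]
    rfl
  exact ⟨HilbertBasis.mk he (Submodule.dense_iff_topologicalClosure_eq_top.1 hd).ge,
    HilbertBasis.coe_mk _ _⟩

/-- Dominated convergence for series, with majorant 4 a n; the finite sums are bounded by the full
series. -/
theorem tendsto_sum_of_tendsto_one {a : ι → ℝ} (ha : Summable a) (ha0 : ∀ n, 0 ≤ a n)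
    (S : ℕ → Finset ι) {q : ℕ → ι → ℂ} (hq1 : ∀ ℓ n, ‖q ℓ n‖ ≤ 1)
    (hq : ∀ n, Tendsto (fun ℓ => q ℓ n) atTop (𝓝 1)) :
    Tendsto (fun ℓ => ∑ n ∈ S ℓ, ‖q ℓ n - 1‖ ^ 2 * a n) atTop (𝓝 0) := by
  have hle : ∀ ℓ n, ‖q ℓ n - 1‖ ^ 2 * a n ≤ 4 * a n := fun ℓ n => by
    refine mul_le_mul_of_nonneg_right ?_ (ha0 n)
    have : ‖q ℓ n - 1‖ ≤ 2 := (norm_sub_le _ _).trans (by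
      rw [norm_one]; linarith [hq1 ℓ n])
    nlinarith [norm_nonneg (q ℓ n - 1)]
  have h4 : Summable fun n => 4 * a n := ha.mul_left 4
  have h := tendsto_tsum_of_dominated_convergence
    (f := fun ℓ n => ‖q ℓ n - 1‖ ^ 2 * a n) (g := fun _ => (0 : ℝ)) h4
    (fun n => by
      have := (((hq n).sub_const 1).norm.pow 2).mul_const (a n)
      simpa using this)
    (Eventually.of_forall fun ℓ n => by
      rw [Real.norm_of_nonneg (mul_nonneg (sq_nonneg _) (ha0 n))]
      exact hle ℓ n)
  rw [tsum_zero] at h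
  refine squeeze_zero (fun ℓ => Finset.sum_nonneg fun n _ => mul_nonneg (sq_nonneg _) (ha0 n))
    (fun ℓ => Summable.sum_le_tsum _ (fun n _ => mul_nonneg (sq_nonneg _) (ha0 n))
      (h4.of_nonneg_of_le (fun n => mul_nonneg (sq_nonneg _) (ha0 n)) (hle ℓ))) h

/-- The finite section method with perturbed data converges for uniformly invertible operators. -/
theorem tendsto_of_isUniformlyInvertible [CompleteSpace H] [DecidableEq ι]
    (b : HilbertBasis ι ℂ H) {S : ℕ → Finset ι} (hS : Tendsto S atTop atTop) {L : H →L[ℂ] H}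
    (hL : IsUniformlyInvertible b S L) {q : ℕ → ι → ℂ} (hq1 : ∀ ℓ n, ‖q ℓ n‖ ≤ 1)
    (hq : ∀ n, Tendsto (fun ℓ => q ℓ n) atTop (𝓝 1)) (g : H) (c : ℕ → ι → ℂ)
    (hc : ∀ ℓ, 1 ≤ ℓ → ∀ n ∈ S ℓ, inner ℂ (L (b n)) (∑ m ∈ S ℓ, c ℓ m • b m) =
      q ℓ n * inner ℂ (L (b n)) g) :
    Tendsto (fun ℓ => ∑ m ∈ S ℓ, c ℓ m • b m) atTop (𝓝 g) := by
  obtain ⟨K, hK⟩ := hL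
  set P : ℕ → H := fun ℓ => ∑ m ∈ S ℓ, b.repr g m • b m with hP
  have hPt : Tendsto P atTop (𝓝 g) := (b.hasSum_repr g).comp hS
  have hadj : ∀ n x, inner ℂ (L (b n)) x = inner ℂ (b n) (L.adjoint x) := fun n x =>
    (ContinuousLinearMap.adjoint_inner_right L (b n) x).symm
  have hsum : Summable fun n => ‖inner ℂ (L (b n)) g‖ ^ 2 := by
    simp_rw [hadj]
    exact b.orthonormal.inner_products_summable _
  have h1 := tendsto_sum_of_tendsto_one hsum (fun n => sq_nonneg _) S hq1 hq
  have h2 : Tendsto (fun ℓ => ‖L.adjoint (g - P ℓ)‖ ^ 2) atTop (𝓝 0) := by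
    have : Tendsto (fun ℓ => L.adjoint (g - P ℓ)) atTop (𝓝 (L.adjoint (g - g))) :=
      (L.adjoint.continuous.tendsto _).comp (hPt.const_sub g)
    simpa using this.norm.pow 2
  -- The stability estimate needs a vector of the span, so the comparison is with the partial sum `P
  -- ℓ` of g. The data error splits into the perturbation q - 1 and the truncation error g - P ℓ,
  -- the latter controlled by Bessel's inequality for the adjoint.
  have hbound : ∀ ℓ, 1 ≤ ℓ → ‖(∑ m ∈ S ℓ, c ℓ m • b m) - P ℓ‖ ^ 2 ≤
      K ^ 2 * (2 * ∑ n ∈ S ℓ, ‖q ℓ n - 1‖ ^ 2 * ‖inner ℂ (L (b n)) g‖ ^ 2 +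
        2 * ‖L.adjoint (g - P ℓ)‖ ^ 2) := by
    intro ℓ hℓ
    have hw : (∑ m ∈ S ℓ, c ℓ m • b m) - P ℓ =
        ∑ m ∈ S ℓ, (fun m => c ℓ m - b.repr g m) m • b m := by
      simp only [hP, sub_smul, Finset.sum_sub_distrib]
    have h := norm_sq_le_of_sectionMatrix b.orthonormal (hK ℓ hℓ).1 (hK ℓ hℓ).2
      fun m => c ℓ m - b.repr g m
    rw [← hw] at h
    refine h.trans (mul_le_mul_of_nonneg_left ?_ (sq_nonneg K))
    have hbessel : ∑ n ∈ S ℓ, ‖inner ℂ (L (b n)) (g - P ℓ)‖ ^ 2 ≤ ‖L.adjoint (g - P ℓ)‖ ^ 2 := by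
      simp_rw [hadj]
      exact b.orthonormal.sum_inner_products_le _
    refine le_trans ?_ (add_le_add_right (mul_le_mul_of_nonneg_left hbessel zero_le_two) _)
    rw [Finset.mul_sum, Finset.mul_sum, ← Finset.sum_add_distrib]
    refine Finset.sum_le_sum fun n hn => ?_
    have hin : inner ℂ (L (b n)) ((∑ m ∈ S ℓ, c ℓ m • b m) - P ℓ) =
        (q ℓ n - 1) * inner ℂ (L (b n)) g + inner ℂ (L (b n)) (g - P ℓ) := by
      rw [inner_sub_right, hc ℓ hℓ n hn, inner_sub_right]
      ring
    rw [hin, ← mul_pow, ← norm_mul]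
    have := norm_add_le ((q ℓ n - 1) * inner ℂ (L (b n)) g) (inner ℂ (L (b n)) (g - P ℓ))
    have h3 := pow_le_pow_left₀ (norm_nonneg _) this 2
    refine h3.trans ?_
    nlinarith [sq_nonneg (‖(q ℓ n - 1) * inner ℂ (L (b n)) g‖ - ‖inner ℂ (L (b n)) (g - P ℓ)‖)]
  have h3 : Tendsto (fun ℓ => ‖(∑ m ∈ S ℓ, c ℓ m • b m) - P ℓ‖ ^ 2) atTop (𝓝 0) := by
    have h4 := ((h1.const_mul 2).add (h2.const_mul 2)).const_mul (K ^ 2)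
    simp only [mul_zero, add_zero] at h4
    exact squeeze_zero' (Eventually.of_forall fun _ => sq_nonneg _)
      ((eventually_ge_atTop 1).mono hbound) h4
  have h5 : Tendsto (fun ℓ => (∑ m ∈ S ℓ, c ℓ m • b m) - P ℓ) atTop (𝓝 0) := by
    rw [tendsto_zero_iff_norm_tendsto_zero]
    have := h3.sqrt
    simpa [Real.sqrt_sq] using this
  simpa using h5.add hPt

end FiniteSections

/-! ### Scalar products of exponentials -/

theorem measurableSet_cube (d : ℕ) (r : ℝ) : MeasurableSet (cube d r) := by
  have h : cube d r = ⋂ i, (fun x : E d => x i) ⁻¹' Set.Icc (-r) r := by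
    ext x
    simp [cube]
  rw [h]
  refine MeasurableSet.iInter fun i => measurableSet_Icc.preimage ?_
  fun_prop

theorem sq_normalization (d : ℕ) :
    ((2 * Real.pi) ^ (-(d : ℝ) / 2)) * ((2 * Real.pi) ^ (-(d : ℝ) / 2)) =
      ((2 * Real.pi) ^ d)⁻¹ := by
  have h : 0 < 2 * Real.pi := by positivity
  rw [← Real.rpow_add h, add_halves, Real.rpow_neg h.le, Real.rpow_natCast]

theorem integral_cube_prod {d : ℕ} (r : ℝ) (f : Fin d → ℝ → ℂ) :
    ∫ x in cube d r, ∏ i, f i (x i) = ∏ i, ∫ s in Set.Icc (-r) r, f i s := by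
  have h := (PiLp.volume_preserving_toLp (Fin d)).setIntegral_preimage_emb
    (MeasurableEquiv.toLp 2 (Fin d → ℝ)).measurableEmbedding (fun x : E d => ∏ i, f i (x i))
    (cube d r)
  rw [← h]
  have hs : (WithLp.toLp 2 : (Fin d → ℝ) → E d) ⁻¹' cube d r =
      Set.univ.pi fun _ => Set.Icc (-r) r := by
    ext x
    simp only [cube, Set.mem_preimage, Set.mem_ofPred_eq, Set.mem_univ_pi]
  rw [hs, volume_pi, Measure.restrict_pi_pi]
  exact integral_fintype_prod_eq_prod (𝕜 := ℂ) f

theorem integral_exp_mul_eq_sinc (a : ℝ) :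
    ∫ s in Set.Icc (-Real.pi) Real.pi, Complex.exp (Complex.I * ((s * a : ℝ) : ℂ)) =
      2 * Real.pi * Real.sinc (Real.pi * a) := by
  have hp := Real.pi_pos
  rw [integral_Icc_eq_integral_Ioc, ← intervalIntegral.integral_of_le (by linarith)]
  rcases eq_or_ne a 0 with rfl | ha
  · simp
    ring
  · have h := intervalIntegral.integral_comp_mul_right
      (fun s : ℝ => Complex.exp (s * Complex.I)) ha (a := -Real.pi) (b := Real.pi)
    have h2 : ∀ s : ℝ, Complex.exp (Complex.I * ((s * a : ℝ) : ℂ)) =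
        (fun s : ℝ => Complex.exp (s * Complex.I)) (s * a) := fun s => by simp [mul_comm]
    simp_rw [h2]
    rw [h, neg_mul, integral_exp_mul_I_eq_sinc]
    have ha' : (a : ℂ) ≠ 0 := by exact_mod_cast ha
    rw [Complex.real_smul]
    push_cast
    field_simp

theorem inner_expL2 {d : ℕ} (s t : E d) :
    inner ℂ (expL2 d s) (expL2 d t) = ((∏ i, Real.sinc (Real.pi * (t i - s i)) : ℝ) : ℂ) := by
  rw [L2.inner_def]
  have h1 : ∫ x, inner ℂ ((expL2 d s : E d → ℂ) x) ((expL2 d t : E d → ℂ) x) ∂cubeMeasure d =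
      ∫ x in cube d Real.pi, (((2 * Real.pi) ^ d)⁻¹ : ℝ) *
        ∏ i, Complex.exp (Complex.I * ((x i * (t i - s i) : ℝ) : ℂ)) := by
    refine integral_congr_ae ?_
    filter_upwards [(memLp_expFun d s).coeFn_toLp, (memLp_expFun d t).coeFn_toLp] with x hs ht
    rw [expL2, expL2, hs, ht, RCLike.inner_apply, expFun, expFun, ← Complex.exp_sum, map_mul,
      Complex.conj_ofReal, ← Complex.exp_conj, ← sq_normalization]
    rw [mul_mul_mul_comm, ← Complex.exp_add, ← Complex.ofReal_mul]
    congr 2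
    rw [map_mul, Complex.conj_I, Complex.conj_ofReal, PiLp.inner_apply, PiLp.inner_apply]
    push_cast
    rw [Finset.mul_sum, Finset.mul_sum, ← Finset.sum_add_distrib]
    refine Finset.sum_congr rfl fun i _ => ?_
    simp
    ring
  rw [h1, integral_const_mul, integral_cube_prod (d := d) Real.pi
    (fun i x => Complex.exp (Complex.I * ((x * (t i - s i) : ℝ) : ℂ)))]
  simp_rw [integral_exp_mul_eq_sinc]
  rw [Finset.prod_mul_distrib, Finset.prod_const, Finset.card_univ, Fintype.card_fin]
  push_cast
  rw [← mul_assoc, inv_mul_cancel₀, one_mul]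
  simp [Real.pi_ne_zero]

theorem norm_expL2 {d : ℕ} (t : E d) : ‖expL2 d t‖ = 1 := by
  have h := inner_expL2 t t
  rw [inner_self_eq_norm_sq_to_K] at h
  have h2 : ‖expL2 d t‖ ^ 2 = 1 := by
    simp only [sub_self, mul_zero, Real.sinc_zero, Finset.prod_const_one] at h
    rw [← Complex.ofReal_inj]
    push_cast at h ⊢
    exact h
  exact (pow_eq_one_iff_of_nonneg (norm_nonneg _) two_ne_zero).1 h2

theorem orthonormal_expL2_latticePoint (d : ℕ) :
    Orthonormal ℂ fun n : Fin d → ℤ => expL2 d (latticePoint d n) := by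
  refine ⟨fun n => norm_expL2 _, fun m n hmn => ?_⟩
  change inner ℂ (expL2 d (latticePoint d m)) (expL2 d (latticePoint d n)) = 0
  rw [inner_expL2, Complex.ofReal_eq_zero, Finset.prod_eq_zero_iff]
  obtain ⟨i, hi⟩ := Function.ne_iff.1 hmn
  refine ⟨i, Finset.mem_univ i, ?_⟩
  have h : latticePoint d n i - latticePoint d m i = ((n i - m i : ℤ) : ℝ) := by
    simp [latticePoint]
  rw [h, Real.sinc_of_ne_zero, mul_comm, Real.sin_int_mul_pi, zero_div]
  refine mul_ne_zero Real.pi_ne_zero ?_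
  exact_mod_cast sub_ne_zero.2 (Ne.symm hi)

/-! ### The Fourier transform of square integrable integrable functions -/

/-- Both transforms are tested against smooth compactly supported functions; each moves onto the
test function, one by the definition for tempered distributions, the other by Fubini. -/
theorem fourier_toLp_ae_eq {d : ℕ} {u : E d → ℂ} (hu : Integrable u) (hu2 : MemLp u 2) :
    (𝓕 (hu2.toLp u) : Lp ℂ 2 (volume : Measure (E d))) =ᵐ[volume] 𝓕 u := by
  have hc : Continuous (𝓕 u) := VectorFourier.fourierIntegral_continuous
    Real.continuous_fourierChar continuous_inner hu
  refine ae_eq_of_integral_contDiff_smul_eq ((Lp.memLp _).locallyIntegrable (by norm_num))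
    hc.locallyIntegrable fun g hg hgs => ?_
  have hg' : ContDiff ℝ (⊤ : ℕ∞) fun x => (g x : ℂ) := Complex.ofRealCLM.contDiff.comp hg
  have hgs' : HasCompactSupport fun x => (g x : ℂ) := hgs.comp_left Complex.ofReal_zero
  set φ : SchwartzMap (E d) ℂ := hgs'.toSchwartzMap hg' with hφ
  have h := congrArg (fun T : TemperedDistribution (E d) ℂ => T φ)
    (Lp.fourier_toTemperedDistribution_eq (hu2.toLp u))
  simp only [TemperedDistribution.fourier_apply, Lp.toTemperedDistribution_apply] at h
  have h2 : ∫ x, (𝓕 φ : SchwartzMap (E d) ℂ) x • (hu2.toLp u) x =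
      ∫ x, (𝓕 φ : SchwartzMap (E d) ℂ) x • u x :=
    integral_congr_ae (hu2.coeFn_toLp.mono fun x hx => by simp only [hx])
  have h3 := VectorFourier.integral_fourierIntegral_smul_eq_flip (μ := volume) (ν := volume)
    (L := innerₗ (E d)) Real.continuous_fourierChar continuous_inner φ.integrable hu
  rw [flip_innerₗ] at h3
  calc ∫ x, g x • (𝓕 (hu2.toLp u) : Lp ℂ 2 (volume : Measure (E d))) x
      = ∫ x, φ x • (𝓕 (hu2.toLp u) : Lp ℂ 2 (volume : Measure (E d))) x :=
        integral_congr_ae (Eventually.of_forall fun x => by simp [hφ])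
    _ = ∫ x, (𝓕 φ : SchwartzMap (E d) ℂ) x • u x := by rw [← h, h2]
    _ = ∫ x, φ x • 𝓕 u x := h3
    _ = ∫ x, g x • 𝓕 u x := integral_congr_ae (Eventually.of_forall fun x => by simp [hφ])

theorem eLpNorm_fourier_eq {d : ℕ} {u : E d → ℂ} (hu : Integrable u) (hu2 : MemLp u 2) :
    eLpNorm (𝓕 u) 2 volume = eLpNorm u 2 volume := by
  rw [← eLpNorm_congr_ae (fourier_toLp_ae_eq hu hu2), ← eLpNorm_congr_ae hu2.coeFn_toLp]
  have h := Lp.norm_fourier_eq (hu2.toLp u)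
  rw [Lp.norm_def, Lp.norm_def] at h
  exact (ENNReal.toReal_eq_toReal_iff' (Lp.eLpNorm_ne_top _) (Lp.eLpNorm_ne_top _)).1 h

/-! ### The Paley-Wiener space -/

theorem map_smul_volume (d : ℕ) {r : ℝ} (hr : r ≠ 0) :
    Measure.map (fun x : E d => r • x) volume =
      ENNReal.ofReal |(r ^ Module.finrank ℝ (E d))⁻¹| • (volume : Measure (E d)) :=
  Measure.map_addHaar_smul volume hr

theorem measurableEmbedding_smul (d : ℕ) {r : ℝ} (hr : r ≠ 0) :
    MeasurableEmbedding (fun x : E d => r • x) :=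
  (Homeomorph.smulOfNeZero r hr).measurableEmbedding

theorem eLpNorm_comp_smul {d : ℕ} {r : ℝ} (hr : r ≠ 0) (f : E d → ℂ) :
    eLpNorm (fun x => f (r • x)) 2 volume =
      ENNReal.ofReal |(r ^ Module.finrank ℝ (E d))⁻¹| ^ (1 / 2 : ℝ) * eLpNorm f 2 volume := by
  have h := (measurableEmbedding_smul d hr).eLpNorm_map_measure (g := f) (p := 2)
    (μ := (volume : Measure (E d)))
  rw [map_smul_volume d hr, eLpNorm_smul_measure_of_ne_top (by norm_num)] at h
  simpa [Function.comp_def] using h.symm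

theorem memLp_comp_smul {d : ℕ} {r : ℝ} (hr : r ≠ 0) {f : E d → ℂ} (hf : MemLp f 2 volume) :
    MemLp (fun x => f (r • x)) 2 volume := by
  refine ((measurableEmbedding_smul d hr).memLp_map_measure_iff (g := f)).1 ?_
  rw [map_smul_volume d hr]
  exact hf.smul_measure ENNReal.ofReal_ne_top

theorem ae_comp_smul {d : ℕ} {r : ℝ} (hr : r ≠ 0) {p : E d → Prop} (h : ∀ᵐ x, p x) :
    ∀ᵐ x : E d, p (r • x) := by
  have h2 : ∀ᵐ x ∂(Measure.map (fun x : E d => r • x) volume), p x := by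
    rw [map_smul_volume d hr]
    exact Measure.ae_smul_measure h _
  exact (measurableEmbedding_smul d hr).ae_map_iff.1 h2

/-- The entire function `t ↦ ⟪ε_t, g⟫`, the unitary Fourier transform of `g`. -/
noncomputable def bandlimited {d : ℕ} (g : L2Cube d) (t : E d) : ℂ := inner ℂ (expL2 d t) g

/-- The function on `ℝ^d` whose Fourier transform in Mathlib's normalization is
`bandlimited g`. -/
noncomputable def spectrumFun {d : ℕ} (g : L2Cube d) (v : E d) : ℂ :=
  (((2 * Real.pi) ^ ((d : ℝ) / 2) : ℝ) : ℂ) *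
    (cube d Real.pi).indicator (g : E d → ℂ) ((2 * Real.pi) • v)

theorem two_pi_ne_zero : 2 * Real.pi ≠ 0 := by positivity

theorem normalization_mul_inv (d : ℕ) :
    (2 * Real.pi) ^ ((d : ℝ) / 2) * (2 * Real.pi) ^ (-(d : ℝ) / 2) = 1 := by
  rw [← Real.rpow_add (by positivity), neg_div, add_neg_cancel, Real.rpow_zero]

theorem memLp_indicator_cube {d : ℕ} (g : L2Cube d) :
    MemLp ((cube d Real.pi).indicator (g : E d → ℂ)) 2 volume :=
  (memLp_indicator_iff_restrict (measurableSet_cube d _)).2 (Lp.memLp g)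

theorem memLp_spectrumFun {d : ℕ} (g : L2Cube d) : MemLp (spectrumFun g) 2 volume :=
  (memLp_comp_smul two_pi_ne_zero (memLp_indicator_cube g)).const_mul _

theorem integrable_spectrumFun {d : ℕ} (g : L2Cube d) : Integrable (spectrumFun g) := by
  have h : Integrable ((cube d Real.pi).indicator (g : E d → ℂ)) :=
    (integrable_indicator_iff (measurableSet_cube d _)).2
      ((Lp.memLp g).integrable (by norm_num))
  exact (h.comp_smul two_pi_ne_zero).const_mul _

theorem fourier_spectrumFun {d : ℕ} (g : L2Cube d) (t : E d) :
    𝓕 (spectrumFun g) t = bandlimited g t := by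
  -- The substitution x = 2πv contributes (2π)^(-d), which turns the factor (2π)^(d/2) of
  -- `spectrumFun` into the normalization (2π)^(-d/2) of the exponentials.
  set Φ : E d → ℂ := fun x => Complex.exp (((-inner ℝ x t : ℝ) : ℂ) * Complex.I) *
    ((((2 * Real.pi) ^ ((d : ℝ) / 2) : ℝ) : ℂ) * (cube d Real.pi).indicator (g : E d → ℂ) x) with hΦ
  have h1 : 𝓕 (spectrumFun g) t = ∫ v, Φ ((2 * Real.pi) • v) := by
    rw [Real.fourier_eq']
    refine integral_congr_ae (Eventually.of_forall fun v => ?_)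
    simp only [hΦ, spectrumFun, smul_eq_mul, inner_smul_left]
    simp
  have h2 : bandlimited g t = ∫ x in cube d Real.pi,
      Complex.exp (((-inner ℝ x t : ℝ) : ℂ) * Complex.I) *
        ((((2 * Real.pi) ^ (-(d : ℝ) / 2) : ℝ) : ℂ) * g x) := by
    rw [bandlimited, L2.inner_def]
    refine integral_congr_ae ?_
    filter_upwards [(memLp_expFun d t).coeFn_toLp] with x hx
    rw [expL2, hx, RCLike.inner_apply, expFun, map_mul, Complex.conj_ofReal, ← Complex.exp_conj,
      map_mul, Complex.conj_I, Complex.conj_ofReal]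
    push_cast
    ring_nf
  rw [h1, Measure.integral_comp_smul, h2, ← integral_indicator (measurableSet_cube d _),
    ← integral_smul]
  refine integral_congr_ae (Eventually.of_forall fun x => ?_)
  simp only [hΦ]
  by_cases hx : x ∈ cube d Real.pi
  · rw [Set.indicator_of_mem hx, Set.indicator_of_mem hx, Complex.real_smul, finrank_euclideanSpace,
      Fintype.card_fin, abs_of_pos (by positivity), ← sq_normalization]
    have h := congrArg (fun r : ℝ => (r : ℂ)) (normalization_mul_inv d)
    simp only [Complex.ofReal_mul, Complex.ofReal_one] at h ⊢
    linear_combination (Complex.exp (((-inner ℝ x t : ℝ) : ℂ) * Complex.I) * g x *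
      (((2 * Real.pi) ^ (-(d : ℝ) / 2) : ℝ) : ℂ)) * h
  · simp [Set.indicator_of_notMem hx]

theorem continuous_bandlimited {d : ℕ} (g : L2Cube d) : Continuous (bandlimited g) := by
  have h : bandlimited g = 𝓕 (spectrumFun g) := (funext (fourier_spectrumFun g)).symm
  rw [h]
  exact VectorFourier.fourierIntegral_continuous
    Real.continuous_fourierChar continuous_inner (integrable_spectrumFun g)

theorem tendsto_bandlimited_cocompact {d : ℕ} (g : L2Cube d) :
    Tendsto (bandlimited g) (cocompact (E d)) (𝓝 0) := by
  have h : bandlimited g = 𝓕 (spectrumFun g) := (funext (fourier_spectrumFun g)).symm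
  rw [h]
  exact tendsto_integral_exp_inner_smul_cocompact (spectrumFun g)

theorem norm_bandlimited_le {d : ℕ} (g : L2Cube d) (t : E d) : ‖bandlimited g t‖ ≤ ‖g‖ := by
  simpa [bandlimited, norm_expL2] using norm_inner_le_norm (𝕜 := ℂ) (expL2 d t) g

/-- Plancherel's theorem. The constant is in fact 1, but only its finiteness matters. -/
theorem exists_eLpNorm_bandlimited_le (d : ℕ) :
    ∃ C : ℝ≥0∞, C ≠ ⊤ ∧ ∀ g : L2Cube d, eLpNorm (bandlimited g) 2 volume ≤ C * ‖g‖ₑ := by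
  refine ⟨‖(((2 * Real.pi) ^ ((d : ℝ) / 2) : ℝ) : ℂ)‖ₑ *
    ENNReal.ofReal |((2 * Real.pi) ^ Module.finrank ℝ (E d))⁻¹| ^ (1 / 2 : ℝ),
    ENNReal.mul_ne_top enorm_ne_top (ENNReal.rpow_ne_top_of_nonneg (by norm_num)
      ENNReal.ofReal_ne_top), fun g => le_of_eq ?_⟩
  have h : bandlimited g = 𝓕 (spectrumFun g) := (funext (fourier_spectrumFun g)).symm
  rw [h, eLpNorm_fourier_eq (integrable_spectrumFun g) (memLp_spectrumFun g)]
  have h2 : spectrumFun g = (((2 * Real.pi) ^ ((d : ℝ) / 2) : ℝ) : ℂ) • fun v =>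
    (cube d Real.pi).indicator (g : E d → ℂ) ((2 * Real.pi) • v) := rfl
  rw [h2, eLpNorm_const_smul, eLpNorm_comp_smul two_pi_ne_zero,
    eLpNorm_indicator_eq_eLpNorm_restrict (measurableSet_cube d _), Lp.enorm_def, mul_assoc]
  rfl

/-- Take g to be the inverse transform of f restricted to the cube. Fourier inversion gives equality
almost everywhere, and continuity makes it pointwise, as the values at the nodes require. -/
theorem exists_bandlimited_eq {d : ℕ} {f : E d → ℂ} (hf : f ∈ PaleyWiener d) :
    ∃ g : L2Cube d, f = bandlimited g := by
  obtain ⟨hc, hf2, hsupp⟩ := hf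
  set U : Lp ℂ 2 (volume : Measure (E d)) := 𝓕⁻ (hf2.toLp f) with hU
  have hinv : MemLp (invFourier d (hf2.toLp f)) 2 volume :=
    (memLp_comp_smul (inv_ne_zero two_pi_ne_zero) (Lp.memLp U)).const_mul _
  have hcube : MemLp (invFourier d (hf2.toLp f)) 2 (cubeMeasure d) :=
    hinv.restrict (cube d Real.pi)
  set g : L2Cube d := hcube.toLp _ with hg
  have hgv : ∀ᵐ x : E d, x ∈ cube d Real.pi → g x = invFourier d (hf2.toLp f) x :=
    (ae_restrict_iff' (measurableSet_cube d _)).1 hcube.coeFn_toLp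
  have hUg : ⇑U =ᵐ[volume] spectrumFun g := by
    filter_upwards [ae_comp_smul two_pi_ne_zero hgv, ae_comp_smul two_pi_ne_zero hsupp]
      with v h1 h2
    have h3 : U v = (((2 * Real.pi) ^ ((d : ℝ) / 2) : ℝ) : ℂ) *
        invFourier d (hf2.toLp f) ((2 * Real.pi) • v) := by
      rw [invFourier, smul_smul, inv_mul_cancel₀ two_pi_ne_zero, one_smul, ← mul_assoc,
        ← Complex.ofReal_mul, normalization_mul_inv, Complex.ofReal_one, one_mul]
    rw [h3, spectrumFun]
    congr 1
    by_cases hx : (2 * Real.pi) • v ∈ cube d Real.pi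
    · rw [Set.indicator_of_mem hx, h1 hx]
    · rw [Set.indicator_of_notMem hx, h2 hx]
  have hUL : U = (memLp_spectrumFun g).toLp _ := by
    refine Lp.ext ?_
    exact hUg.trans (memLp_spectrumFun g).coeFn_toLp.symm
  have hF : (𝓕 U : Lp ℂ 2 (volume : Measure (E d))) = hf2.toLp f :=
    FourierTransform.fourier_fourierInv_eq _
  have h4 := fourier_toLp_ae_eq (integrable_spectrumFun g) (memLp_spectrumFun g)
  rw [← hUL, hF] at h4
  refine ⟨g, (hc.ae_eq_iff_eq volume (continuous_bandlimited g)).1 ?_⟩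
  filter_upwards [h4, hf2.coeFn_toLp] with x h5 h6
  rw [← h6, h5, fourier_spectrumFun]

/-! ### Polynomials times tails of the sine product -/

theorem bandlimited_sum_smul {d : ℕ} (S : Finset (Fin d → ℤ)) (c : (Fin d → ℤ) → ℂ) (x : E d) :
    bandlimited (∑ n ∈ S, c n • expL2 d (latticePoint d n)) x =
      ∑ n ∈ S, c n * ((∏ i, Real.sinc (Real.pi * (x i - n i)) : ℝ) : ℂ) := by
  rw [bandlimited, inner_sum]
  refine Finset.sum_congr rfl fun n _ => ?_
  rw [inner_smul_right, inner_expL2]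
  congr 2
  refine Finset.prod_congr rfl fun i _ => ?_
  rw [← Real.sinc_neg, ← mul_neg, neg_sub]
  rfl

/-- The function `x ↦ ∏ i, ∏ k > ℓ, (1 - (x i)² / k²)`. -/
noncomputable def cubeSineTail {d : ℕ} (ℓ : ℕ) (x : E d) : ℝ := ∏ i, sineTail ℓ (x i)

theorem continuous_cubeSineTail {d : ℕ} (ℓ : ℕ) : Continuous (cubeSineTail ℓ : E d → ℝ) := by
  unfold cubeSineTail
  have := continuous_sineTail ℓ
  fun_prop

theorem abs_cubeSineTail_le_one {d : ℕ} (ℓ : ℕ) (x : E d) : |cubeSineTail ℓ x| ≤ 1 := by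
  rw [cubeSineTail, Finset.abs_prod]
  exact Finset.prod_le_one (fun _ _ => abs_nonneg _) fun i _ => abs_sineTail_le_one ℓ _

theorem monomial_mul_cubeSineTail {d ℓ : ℕ} {m : Fin d → ℕ} (hm : ∀ i, m i ≤ 2 * ℓ) (x : E d) :
    (∏ i, x i ^ m i) * cubeSineTail ℓ x = ∑ n ∈ indexCube d ℓ,
      (∏ i, ((n i : ℝ) ^ m i * sincCoeff ℓ (n i))) * ∏ i, Real.sinc (Real.pi * (x i - n i)) := by
  rw [cubeSineTail, ← Finset.prod_mul_distrib, indexCube]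
  simp_rw [← Finset.prod_mul_distrib]
  rw [Finset.sum_prod_piFinset (Finset.Icc (-(ℓ : ℤ)) (ℓ : ℤ)) fun i n =>
    ((n : ℝ) ^ m i * sincCoeff ℓ n) * Real.sinc (Real.pi * (x i - n))]
  refine Finset.prod_congr rfl fun i _ => ?_
  rw [pow_mul_sineTail (hm i)]
  exact Finset.sum_congr rfl fun n _ => by ring

/-- For a monomial this is a product of one-variable identities, expanded over the grid of nodes. It
translates polynomial interpolation into a problem in the span of the lattice exponentials. -/
theorem exists_bandlimited_eq_polyEval_mul {d ℓ : ℕ} {p : MvPolynomial (Fin d) ℂ}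
    (hp : ∀ i, p.degreeOf i ≤ 2 * ℓ) :
    ∃ c : (Fin d → ℤ) → ℂ, ∀ x : E d, polyEval p x * (cubeSineTail ℓ x : ℂ) =
      bandlimited (∑ n ∈ indexCube d ℓ, c n • expL2 d (latticePoint d n)) x := by
  refine ⟨fun n => ∑ m ∈ p.support, p.coeff m *
    ((∏ i, ((n i : ℝ) ^ m i * sincCoeff ℓ (n i)) : ℝ) : ℂ), fun x => ?_⟩
  rw [bandlimited_sum_smul, polyEval, MvPolynomial.eval_eq', Finset.sum_mul]
  simp_rw [Finset.sum_mul]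
  rw [Finset.sum_comm]
  refine Finset.sum_congr rfl fun m hm => ?_
  have h := monomial_mul_cubeSineTail (ℓ := ℓ) (m := m)
    (fun i => (MvPolynomial.monomial_le_degreeOf i hm).trans (hp i)) x
  have h2 := congrArg (fun r : ℝ => (r : ℂ)) h
  simp only [Complex.ofReal_mul, Complex.ofReal_sum, Complex.ofReal_prod, Complex.ofReal_pow]
    at h2 ⊢
  rw [mul_assoc, h2, Finset.mul_sum]
  exact Finset.sum_congr rfl fun n _ => by ring

theorem eq_zero_of_polyEval_mul_eq_zero {d ℓ : ℕ} {p : MvPolynomial (Fin d) ℂ}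
    (h : ∀ x : E d, polyEval p x * (cubeSineTail ℓ x : ℂ) = 0) : p = 0 := by
  -- For every ℓ the interval (0, 1/4) lies in the range |s| < (ℓ + 1/2)/2 where the tail is known
  -- to be positive.
  have hinf : ((fun s : ℝ => (s : ℂ)) '' Set.Ioo 0 (1 / 4)).Infinite :=
    (Set.Ioo_infinite (by norm_num)).image Complex.ofReal_injective.injOn
  refine MvPolynomial.funext_set (fun _ => (fun s : ℝ => (s : ℂ)) '' Set.Ioo 0 (1 / 4))
    (fun _ => hinf) fun z hz => ?_
  choose s hs hsz using fun i => hz i (Set.mem_univ i)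
  have hx := h (WithLp.toLp 2 s)
  have hpos : 0 < cubeSineTail ℓ (WithLp.toLp 2 s : E d) := by
    refine Finset.prod_pos fun i _ => sineTail_pos ?_
    have hℓ : (0 : ℝ) ≤ ℓ := Nat.cast_nonneg ℓ
    change |s i| < _
    rw [abs_of_pos (hs i).1]
    linarith [(hs i).2]
  have h2 := (mul_eq_zero.1 hx).resolve_right (by exact_mod_cast hpos.ne')
  rw [map_zero, ← h2, polyEval]
  congr 1
  exact congrArg _ (funext fun i => (hsz i).symm)

/-! ### Existence and uniqueness of the interpolating polynomial -/

/-- The spectrum of p·Q_ℓ lies in the span and is orthogonal to every L ε_n with n in the index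
cube, so stability makes it zero. -/
theorem eq_zero_of_polyEval_nodes {d ℓ : ℕ} {t : (Fin d → ℤ) → E d}
    {L : L2Cube d →L[ℂ] L2Cube d} (hL : ∀ n, L (expL2 d (latticePoint d n)) = expL2 d (t n))
    (hS : IsUnit (sectionMatrix (fun n => expL2 d (latticePoint d n)) L (indexCube d ℓ)))
    {p : MvPolynomial (Fin d) ℂ} (hp : ∀ i, p.degreeOf i ≤ 2 * ℓ)
    (h0 : ∀ n ∈ indexCube d ℓ, polyEval p (t n) = 0) : p = 0 := by
  obtain ⟨c, hc⟩ := exists_bandlimited_eq_polyEval_mul hp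
  have h := norm_sq_le_of_sectionMatrix (orthonormal_expL2_latticePoint d) hS le_rfl c
  have hz : ∑ n ∈ indexCube d ℓ, ‖inner ℂ (L (expL2 d (latticePoint d n)))
      (∑ m ∈ indexCube d ℓ, c m • expL2 d (latticePoint d m))‖ ^ 2 = 0 := by
    refine Finset.sum_eq_zero fun n hn => ?_
    have h2 := hc (t n)
    rw [h0 n hn, zero_mul, bandlimited] at h2
    rw [hL, ← h2, norm_zero, zero_pow two_ne_zero]
  rw [hz, mul_zero] at h
  have hw : ∑ m ∈ indexCube d ℓ, c m • expL2 d (latticePoint d m) = 0 := by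
    rw [← norm_eq_zero]
    exact pow_eq_zero_iff two_ne_zero |>.1 (le_antisymm h (sq_nonneg _))
  refine eq_zero_of_polyEval_mul_eq_zero (ℓ := ℓ) fun x => ?_
  rw [hc, hw, bandlimited, inner_zero_right]

/-- The polynomial with given coefficients at the monomials of degree at most `k` in each
variable. -/
noncomputable def boxPolynomial (d k : ℕ) :
    ((Fin d → Fin (k + 1)) → ℂ) →ₗ[ℂ] MvPolynomial (Fin d) ℂ :=
  ∑ α : Fin d → Fin (k + 1),
    (MvPolynomial.monomial (Finsupp.equivFunOnFinite.symm fun i => (α i : ℕ))).comp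
      (LinearMap.proj α)

theorem boxPolynomial_apply {d k : ℕ} (c : (Fin d → Fin (k + 1)) → ℂ) :
    boxPolynomial d k c = ∑ α : Fin d → Fin (k + 1),
      MvPolynomial.monomial (Finsupp.equivFunOnFinite.symm fun i => (α i : ℕ)) (c α) := by
  simp [boxPolynomial]

theorem degreeOf_boxPolynomial_le {d k : ℕ} (c : (Fin d → Fin (k + 1)) → ℂ) (i : Fin d) :
    (boxPolynomial d k c).degreeOf i ≤ k := by
  rw [boxPolynomial_apply]
  refine (MvPolynomial.degreeOf_sum_le i _ _).trans (Finset.sup_le fun α _ => ?_)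
  by_cases h : c α = 0
  · simp [h]
  · rw [MvPolynomial.degreeOf_monomial_eq _ _ h]
    exact Nat.lt_succ_iff.1 (α i).2

theorem boxPolynomial_injective (d k : ℕ) : Function.Injective (boxPolynomial d k) := by
  rw [injective_iff_map_eq_zero]
  intro c hc
  funext β
  have h := congrArg
    (MvPolynomial.coeff (Finsupp.equivFunOnFinite.symm fun i => (β i : ℕ))) hc
  rw [boxPolynomial_apply, MvPolynomial.coeff_sum, Finset.sum_eq_single β] at h
  · simpa using h
  · intro α _ hαβ
    rw [MvPolynomial.coeff_monomial, if_neg]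
    intro he
    refine hαβ (funext fun i => Fin.ext ?_)
    exact congrFun (Finsupp.equivFunOnFinite.symm.injective he) i
  · simp

theorem card_indexCube (d ℓ : ℕ) : (indexCube d ℓ).card = (2 * ℓ + 1) ^ d := by
  rw [indexCube, Fintype.card_piFinset_const, Int.card_Icc]
  congr 1
  omega

/-- Evaluation at the nodes is a square linear system of size (2ℓ+1)^d, so injectivity implies
surjectivity. -/
theorem existsUnique_isInterpolant {d ℓ : ℕ} {t : (Fin d → ℤ) → E d}
    {L : L2Cube d →L[ℂ] L2Cube d} (hL : ∀ n, L (expL2 d (latticePoint d n)) = expL2 d (t n))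
    (hS : IsUnit (sectionMatrix (fun n => expL2 d (latticePoint d n)) L (indexCube d ℓ)))
    (f : E d → ℂ) : ∃! p : MvPolynomial (Fin d) ℂ, IsInterpolant t f ℓ p := by
  set T : ((Fin d → Fin (2 * ℓ + 1)) → ℂ) →ₗ[ℂ] (indexCube d ℓ → ℂ) :=
    LinearMap.pi fun n => (MvPolynomial.aeval (R := ℂ)
      (fun i => ((t n i : ℝ) : ℂ))).toLinearMap.comp (boxPolynomial d (2 * ℓ)) with hT
  have hTa : ∀ c n, T c n = polyEval (boxPolynomial d (2 * ℓ) c) (t n) := fun c n => by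
    simp [hT, polyEval]
  have hinj : Function.Injective T := by
    rw [injective_iff_map_eq_zero]
    intro c hc
    refine (injective_iff_map_eq_zero _).1 (boxPolynomial_injective d (2 * ℓ)) c ?_
    refine eq_zero_of_polyEval_nodes hL hS (degreeOf_boxPolynomial_le c) fun n hn => ?_
    rw [← hTa c ⟨n, hn⟩, hc]
    rfl
  have hfin : Module.finrank ℂ ((Fin d → Fin (2 * ℓ + 1)) → ℂ) =
      Module.finrank ℂ (indexCube d ℓ → ℂ) := by
    rw [Module.finrank_fintype_fun_eq_card, Module.finrank_fintype_fun_eq_card,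
      Fintype.card_coe, card_indexCube]
    simp
  obtain ⟨c, hc⟩ := (LinearMap.injective_iff_surjective_of_finrank_eq_finrank hfin).1 hinj
    fun n => f (t n)
  refine ⟨boxPolynomial d (2 * ℓ) c, ⟨degreeOf_boxPolynomial_le c, fun n hn => ?_⟩, ?_⟩
  · rw [← hTa c ⟨n, hn⟩, hc]
  · rintro p ⟨hp1, hp2⟩
    rw [← sub_eq_zero]
    refine eq_zero_of_polyEval_nodes hL hS (fun i => ?_) fun n hn => ?_
    · exact (MvPolynomial.degreeOf_sub_le i _ _).trans
        (max_le (hp1 i) (degreeOf_boxPolynomial_le c i))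
    · have h := hTa c ⟨n, hn⟩
      rw [hc] at h
      rw [polyEval, map_sub, sub_eq_zero]
      exact (hp2 n hn).trans h

/-! ### Comparison of the multiplier with the tail of the sine product -/

theorem sum_fin_le_mul {d : ℕ} {f : Fin d → ℝ} {b : ℝ} (h : ∀ i, f i ≤ b) :
    ∑ i, f i ≤ d * b := by
  simpa using Finset.sum_le_card_nsmul Finset.univ f b fun i _ => h i

theorem multiplier_eq_exp_sum {d : ℕ} (N ℓ : ℕ) (x : E d) :
    multiplier N ℓ x = Real.exp (-∑ i, tailExponent N ℓ (x i)) := by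
  simp only [multiplier, tailExponent]
  rw [Finset.sum_comm]
  congr 2
  refine Finset.sum_congr rfl fun k _ => ?_
  rw [Finset.sum_div, Finset.mul_sum]

theorem tailExponent_nonneg (N ℓ : ℕ) (t : ℝ) : 0 ≤ tailExponent N ℓ t := by
  refine Finset.sum_nonneg fun k hk => mul_nonneg ?_ (by positivity)
  have h : (1 : ℝ) ≤ k := by exact_mod_cast (Finset.mem_Icc.1 hk).1
  exact one_div_nonneg.2 (mul_nonneg (by linarith) (by linarith))

theorem tailExponent_le_of_abs_le (N ℓ : ℕ) {s t : ℝ} (h : |s| ≤ t) :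
    tailExponent N ℓ s ≤ tailExponent N ℓ t := by
  refine Finset.sum_le_sum fun k hk => ?_
  have hk1 : (1 : ℝ) ≤ k := by exact_mod_cast (Finset.mem_Icc.1 hk).1
  refine mul_le_mul_of_nonneg_left ?_ (one_div_nonneg.2 (mul_nonneg (by linarith) (by linarith)))
  have h2 : |s| ≤ |t| := h.trans (le_abs_self t)
  gcongr

theorem tendsto_natCast_add_half : Tendsto (fun ℓ : ℕ => (ℓ : ℝ) + 1 / 2) atTop atTop :=
  tendsto_atTop_add_const_right _ _ tendsto_natCast_atTop_atTop

theorem tendsto_tailExponent (N : ℕ) (t : ℝ) :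
    Tendsto (fun ℓ => tailExponent N ℓ t) atTop (𝓝 0) := by
  rw [← Finset.sum_const_zero (s := Finset.Icc 1 N) (ι := ℕ) (M := ℝ)]
  refine tendsto_finsetSum _ fun k hk => ?_
  have hk1 : 2 * k - 1 ≠ 0 := by have := (Finset.mem_Icc.1 hk).1; omega
  have h := ((tendsto_pow_atTop hk1).comp tendsto_natCast_add_half).const_div_atTop (|t| ^ (2 * k))
  simpa using h.const_mul (1 / ((k : ℝ) * (2 * (k : ℝ) - 1)))

theorem continuous_multiplier {d : ℕ} (N ℓ : ℕ) : Continuous (multiplier N ℓ : E d → ℝ) := by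
  unfold multiplier
  fun_prop

theorem multiplier_le_one {d : ℕ} (N ℓ : ℕ) (x : E d) : multiplier N ℓ x ≤ 1 := by
  rw [multiplier_eq_exp_sum, Real.exp_le_one_iff, neg_nonpos]
  exact Finset.sum_nonneg fun i _ => tailExponent_nonneg N ℓ _

theorem multiplier_le_mul_cubeSineTail {d ℓ : ℕ} (N : ℕ) {x : E d}
    (hx : ∀ i, |x i| < ((ℓ : ℝ) + 1 / 2) / 2) :
    multiplier N ℓ x ≤ Real.exp (∑ i, 2 * x i ^ (2 * N + 2) / ((ℓ : ℝ) + 1 / 2) ^ (2 * N + 1)) *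
      cubeSineTail ℓ x := by
  have h : Real.exp (∑ i, -(tailExponent N ℓ (x i) +
      2 * x i ^ (2 * N + 2) / ((ℓ : ℝ) + 1 / 2) ^ (2 * N + 1))) ≤ cubeSineTail ℓ x := by
    rw [Real.exp_sum]
    exact Finset.prod_le_prod (fun _ _ => (Real.exp_pos _).le)
      fun i _ => exp_neg_tailExponent_le_sineTail N (hx i)
  refine le_trans (le_of_eq ?_) (mul_le_mul_of_nonneg_left h (Real.exp_pos _).le)
  rw [multiplier_eq_exp_sum, ← Real.exp_add, Finset.sum_neg_distrib, Finset.sum_add_distrib]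
  congr 1
  ring

theorem cubeSineTail_pos {d ℓ : ℕ} {x : E d} (hx : ∀ i, |x i| < ((ℓ : ℝ) + 1 / 2) / 2) :
    0 < cubeSineTail ℓ x :=
  Finset.prod_pos fun i _ => sineTail_pos (hx i)

/-- This is the comparison for N = 0, where the multiplier is 1. For fixed r the exponent tends to
0, so Q_ℓ → 1 uniformly on fixed cubes. -/
theorem exp_neg_le_cubeSineTail {d ℓ : ℕ} {r : ℝ} {x : E d} (hx : x ∈ cube d r)
    (hr : r < ((ℓ : ℝ) + 1 / 2) / 2) :
    Real.exp (-(d * (2 * r ^ 2 / ((ℓ : ℝ) + 1 / 2)))) ≤ cubeSineTail ℓ x := by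
  have hxr : ∀ i, |x i| ≤ r := fun i => abs_le.2 (hx i)
  have h := multiplier_le_mul_cubeSineTail 0 fun i => (hxr i).trans_lt hr
  rw [multiplier_eq_exp_sum] at h
  simp only [tailExponent, Finset.Icc_eq_empty_of_lt Nat.zero_lt_one, Finset.sum_empty,
    Finset.sum_const_zero, neg_zero, Real.exp_zero, mul_zero, zero_add, pow_one] at h
  have h2 : ∑ i, 2 * x i ^ 2 / ((ℓ : ℝ) + 1 / 2) ≤ d * (2 * r ^ 2 / ((ℓ : ℝ) + 1 / 2)) := by
    refine sum_fin_le_mul fun i => ?_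
    have := sq_le_sq' (hx i).1 (hx i).2
    gcongr
  have hpos := cubeSineTail_pos fun i => (hxr i).trans_lt hr
  have h3 : 1 ≤ Real.exp (d * (2 * r ^ 2 / ((ℓ : ℝ) + 1 / 2))) * cubeSineTail ℓ x :=
    h.trans (mul_le_mul_of_nonneg_right (Real.exp_le_exp.2 h2) hpos.le)
  rw [Real.exp_neg, inv_le_iff_one_le_mul₀ (Real.exp_pos _), mul_comm]
  exact h3

theorem tendsto_quadratic_exponent (d : ℕ) (r : ℝ) :
    Tendsto (fun ℓ : ℕ => (d : ℝ) * (2 * r ^ 2 / ((ℓ : ℝ) + 1 / 2))) atTop (𝓝 0) := by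
  simpa using (tendsto_natCast_add_half.const_div_atTop (2 * r ^ 2)).const_mul (d : ℝ)

theorem eventually_lt_half_natCast_add_half (r : ℝ) :
    ∀ᶠ ℓ : ℕ in atTop, r < ((ℓ : ℝ) + 1 / 2) / 2 := by
  filter_upwards [tendsto_natCast_add_half.eventually_gt_atTop (2 * r)] with ℓ h
  linarith

theorem mem_cube_norm {d : ℕ} (x : E d) : x ∈ cube d ‖x‖ := fun i =>
  abs_le.1 (PiLp.norm_apply_le x i)

theorem tendsto_cubeSineTail {d : ℕ} (x : E d) :
    Tendsto (fun ℓ => cubeSineTail ℓ x) atTop (𝓝 1) := by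
  have h := (Real.continuous_exp.tendsto _).comp (tendsto_quadratic_exponent d ‖x‖).neg
  rw [neg_zero, Real.exp_zero] at h
  refine tendsto_of_tendsto_of_tendsto_of_le_of_le' h tendsto_const_nhds ?_
    (Eventually.of_forall fun ℓ => (abs_le.1 (abs_cubeSineTail_le_one ℓ x)).2)
  filter_upwards [eventually_lt_half_natCast_add_half ‖x‖] with ℓ hℓ
  exact exp_neg_le_cubeSineTail (mem_cube_norm x) hℓ

/-- Both m and Q_ℓ are at most 1, so m ≤ m/Q_ℓ ≤ 1/Q_ℓ, and the outer terms tend to 1 uniformly on a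
fixed cube. -/
theorem eventually_abs_ratio_sub_one_le (d N : ℕ) (r : ℝ) {ε : ℝ} (hε : 0 < ε) :
    ∀ᶠ ℓ : ℕ in atTop, ∀ x ∈ cube d r, |multiplier N ℓ x / cubeSineTail ℓ x - 1| ≤ ε := by
  have h1 := (Real.continuous_exp.tendsto _).comp (tendsto_quadratic_exponent d r)
  have h2 := (Real.continuous_exp.tendsto _).comp ((tendsto_tailExponent N r).const_mul (d : ℝ)).neg
  rw [Real.exp_zero] at h1
  rw [mul_zero, neg_zero, Real.exp_zero] at h2
  filter_upwards [h1.eventually_le_const (show 1 < 1 + ε by linarith),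
    h2.eventually_const_le (show 1 - ε < 1 by linarith), eventually_lt_half_natCast_add_half r]
    with ℓ h3 h4 h5 x hx
  have hxr : ∀ i, |x i| ≤ r := fun i => abs_le.2 (hx i)
  have hpos := cubeSineTail_pos fun i => (hxr i).trans_lt h5
  have hQ1 := (abs_le.1 (abs_cubeSineTail_le_one ℓ x)).2
  have hQ := exp_neg_le_cubeSineTail hx h5
  have hm : 1 - ε ≤ multiplier N ℓ x := by
    refine h4.trans ?_
    rw [multiplier_eq_exp_sum]
    refine Real.exp_le_exp.2 (neg_le_neg ?_)
    refine sum_fin_le_mul fun i => ?_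
    exact tailExponent_le_of_abs_le N ℓ (hxr i)
  have hm0 : 0 < multiplier N ℓ x := Real.exp_pos _
  rw [abs_le]
  constructor
  · have : multiplier N ℓ x ≤ multiplier N ℓ x / cubeSineTail ℓ x :=
      le_div_self hm0.le hpos hQ1
    linarith
  · have : multiplier N ℓ x / cubeSineTail ℓ x ≤ 1 + ε := by
      rw [div_le_iff₀ hpos]
      rw [Real.exp_neg, inv_le_iff_one_le_mul₀ (Real.exp_pos _)] at hQ
      calc multiplier N ℓ x ≤ 1 := multiplier_le_one N ℓ x
        _ ≤ _ := hQ
        _ ≤ cubeSineTail ℓ x * (1 + ε) := mul_le_mul_of_nonneg_left h3 hpos.le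
        _ = _ := mul_comm _ _
    linarith

/-- The growth exponent is chosen for this identity: it keeps the remainder 2
x^(2N+2)/(ℓ+1/2)^(2N+1) below 2 A^(2N+2) on the growing cube. -/
theorem halfSide_pow (N : ℕ) (A : ℝ) (ℓ : ℕ) :
    halfSide N A ℓ ^ (2 * N + 2) = A ^ (2 * N + 2) * ((ℓ : ℝ) + 1 / 2) ^ (2 * N + 1) := by
  have hpos' : 0 ≤ (ℓ : ℝ) + 1 / 2 := by positivity
  rw [halfSide, mul_pow, ← Real.rpow_mul_natCast hpos', ← Real.rpow_natCast _ (2 * N + 1)]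
  congr 2
  push_cast
  field_simp

theorem eventually_halfSide_lt (N : ℕ) (A : ℝ) :
    ∀ᶠ ℓ : ℕ in atTop, halfSide N A ℓ < ((ℓ : ℝ) + 1 / 2) / 2 := by
  filter_upwards [tendsto_natCast_add_half.eventually_gt_atTop ((2 * A) ^ (2 * N + 2))] with ℓ h
  have hpos' : 0 < (ℓ : ℝ) + 1 / 2 := by positivity
  refine lt_of_pow_lt_pow_left₀ (2 * N + 2) (by positivity) ?_
  have h2 := mul_lt_mul_of_pos_right h (pow_pos hpos' (2 * N + 1))
  rw [halfSide_pow, div_pow, lt_div_iff₀ (by positivity)]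
  calc _ = (2 * A) ^ (2 * N + 2) * ((ℓ : ℝ) + 1 / 2) ^ (2 * N + 1) := by rw [mul_pow]; ring
    _ < _ := h2
    _ = _ := by ring

theorem ratio_le_of_mem_cube_halfSide {d N ℓ : ℕ} {A : ℝ} {x : E d}
    (hx : x ∈ cube d (halfSide N A ℓ)) (hℓ : halfSide N A ℓ < ((ℓ : ℝ) + 1 / 2) / 2) :
    multiplier N ℓ x / cubeSineTail ℓ x ≤ Real.exp (d * (2 * A ^ (2 * N + 2))) := by
  have hxr : ∀ i, |x i| ≤ halfSide N A ℓ := fun i => abs_le.2 (hx i)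
  have hpos := cubeSineTail_pos fun i => (hxr i).trans_lt hℓ
  rw [div_le_iff₀ hpos]
  refine (multiplier_le_mul_cubeSineTail N fun i => (hxr i).trans_lt hℓ).trans
    (mul_le_mul_of_nonneg_right (Real.exp_le_exp.2 ?_) hpos.le)
  refine sum_fin_le_mul fun i => ?_
  rw [div_le_iff₀ (by positivity), mul_assoc, ← halfSide_pow]
  have h := pow_le_pow_left₀ (abs_nonneg _) (hxr i) (2 * N + 2)
  rw [(by ring : 2 * N + 2 = 2 * (N + 1)), pow_mul |x i|, sq_abs, ← pow_mul] at h
  rw [(by ring : 2 * N + 2 = 2 * (N + 1))]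
  linarith

/-! ### Convergence on the growing cubes -/

theorem tendsto_indexCube (d : ℕ) : Tendsto (indexCube d) atTop atTop := by
  refine tendsto_atTop_finset_of_monotone (fun k ℓ hkℓ => ?_) fun n => ?_
  · refine Fintype.piFinset_subset _ _ fun i => ?_
    have : (k : ℤ) ≤ ℓ := by exact_mod_cast hkℓ
    exact Finset.Icc_subset_Icc (by omega) this
  · refine ⟨∑ i, (n i).natAbs, Fintype.mem_piFinset.2 fun i => ?_⟩
    have h : (n i).natAbs ≤ ∑ i, (n i).natAbs :=
      Finset.single_le_sum (f := fun i => (n i).natAbs) (fun _ _ => Nat.zero_le _)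
        (Finset.mem_univ i)
    rw [Finset.mem_Icc]
    omega

/-- G ℓ is the spectrum of Ψ_ℓ Q_ℓ. Interpolation says that it solves the finite section system for
g with the data multiplied by q = Q_ℓ(t n), which is bounded by 1 and tends to 1. -/
theorem exists_tendsto_spectrum {d : ℕ} {t : (Fin d → ℤ) → E d}
    (ht : IsUniformlyInvertibleRieszBasis (fun n => expL2 d (latticePoint d n)) (indexCube d)
      (fun n => expL2 d (t n))) (g : L2Cube d) {Ψ : ℕ → MvPolynomial (Fin d) ℂ}
    (hΨ : ∀ ℓ, 1 ≤ ℓ → IsInterpolant t (bandlimited g) ℓ (Ψ ℓ)) :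
    ∃ G : ℕ → L2Cube d, Tendsto G atTop (𝓝 g) ∧
      ∀ ℓ, 1 ≤ ℓ → ∀ x, polyEval (Ψ ℓ) x * (cubeSineTail ℓ x : ℂ) = bandlimited (G ℓ) x := by
  obtain ⟨hR, L, hL, hU⟩ := ht
  obtain ⟨b, hb⟩ := hilbertBasis_of_isRieszBasis (orthonormal_expL2_latticePoint d) hR L hL
  have hc : ∀ ℓ, ∃ c : (Fin d → ℤ) → ℂ, 1 ≤ ℓ → ∀ x : E d,
      polyEval (Ψ ℓ) x * (cubeSineTail ℓ x : ℂ) =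
        bandlimited (∑ n ∈ indexCube d ℓ, c n • expL2 d (latticePoint d n)) x := by
    intro ℓ
    by_cases h : 1 ≤ ℓ
    · obtain ⟨c, hc⟩ := exists_bandlimited_eq_polyEval_mul (hΨ ℓ h).1
      exact ⟨c, fun _ => hc⟩
    -- Nothing is assumed about Ψ 0; the coefficients there are an arbitrary default.
    · exact ⟨0, fun h' => absurd h' h⟩
  choose c hc using hc
  rw [← hb] at hU
  have hconv := tendsto_of_isUniformlyInvertible b (tendsto_indexCube d) hU
    (q := fun ℓ n => (cubeSineTail ℓ (t n) : ℂ))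
    (fun ℓ n => by
      rw [Complex.norm_real, Real.norm_eq_abs]
      exact abs_cubeSineTail_le_one ℓ _)
    (fun n => by
      have h := (Complex.continuous_ofReal.tendsto _).comp (tendsto_cubeSineTail (t n))
      rwa [Complex.ofReal_one] at h)
    g c (fun ℓ hℓ n hn => by
      have h := hc ℓ hℓ (t n)
      rw [(hΨ ℓ hℓ).2 n hn] at h
      simp only [hb]
      rw [ContinuousLinearEquiv.coe_coe, hL]
      exact h.symm.trans (mul_comm _ _))
  simp only [hb] at hconv
  exact ⟨_, hconv, hc⟩

theorem norm_sub_mul_multiplier_le {d N ℓ : ℕ} {A : ℝ} {g G : L2Cube d}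
    {p : MvPolynomial (Fin d) ℂ}
    (hp : ∀ x, polyEval p x * (cubeSineTail ℓ x : ℂ) = bandlimited G x)
    (hℓ : halfSide N A ℓ < ((ℓ : ℝ) + 1 / 2) / 2) {x : E d} (hx : x ∈ cube d (halfSide N A ℓ)) :
    ‖bandlimited g x - polyEval p x * ((multiplier N ℓ x : ℝ) : ℂ)‖ ≤
      Real.exp (d * (2 * A ^ (2 * N + 2))) * ‖bandlimited (g - G) x‖ +
        ‖bandlimited g x‖ * |multiplier N ℓ x / cubeSineTail ℓ x - 1| := by
  have hpos := cubeSineTail_pos fun i => (abs_le.2 (hx i)).trans_lt hℓ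
  have hQ : (cubeSineTail ℓ x : ℂ) ≠ 0 := by exact_mod_cast hpos.ne'
  have hsub : bandlimited (g - G) x = bandlimited g x - bandlimited G x := inner_sub_right _ _ _
  -- The error splits into the interpolation error weighted by m/Q_ℓ and the error of replacing Q_ℓ
  -- by m.
  have hid : bandlimited g x - polyEval p x * ((multiplier N ℓ x : ℝ) : ℂ) =
      ((multiplier N ℓ x / cubeSineTail ℓ x : ℝ) : ℂ) * bandlimited (g - G) x -
        bandlimited g x * ((multiplier N ℓ x / cubeSineTail ℓ x - 1 : ℝ) : ℂ) := by
    rw [hsub, ← hp]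
    push_cast
    field_simp
    ring
  rw [hid]
  refine (norm_sub_le _ _).trans ?_
  rw [norm_mul, norm_mul, Complex.norm_real, Complex.norm_real, Real.norm_eq_abs,
    Real.norm_eq_abs, abs_of_nonneg (div_nonneg (Real.exp_pos _).le hpos.le : 0 ≤ multiplier N ℓ x / cubeSineTail ℓ x)]
  gcongr
  exact ratio_le_of_mem_cube_halfSide hx hℓ

theorem abs_ratio_sub_one_le {d N ℓ : ℕ} {A : ℝ} {x : E d}
    (hℓ : halfSide N A ℓ < ((ℓ : ℝ) + 1 / 2) / 2) (hx : x ∈ cube d (halfSide N A ℓ)) :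
    |multiplier N ℓ x / cubeSineTail ℓ x - 1| ≤ Real.exp (d * (2 * A ^ (2 * N + 2))) + 1 := by
  have hpos := cubeSineTail_pos fun i => (abs_le.2 (hx i)).trans_lt hℓ
  have h0 : 0 ≤ multiplier N ℓ x / cubeSineTail ℓ x := div_nonneg (Real.exp_pos _).le hpos.le
  have h1 := ratio_le_of_mem_cube_halfSide hx hℓ
  rw [abs_le]
  constructor <;> linarith

/-- The Riemann–Lebesgue lemma. -/
theorem exists_norm_bandlimited_le_off_cube {d : ℕ} (g : L2Cube d) {ε : ℝ} (hε : 0 < ε) :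
    ∃ r : ℝ, ∀ x ∉ cube d r, ‖bandlimited g x‖ ≤ ε := by
  have h := (tendsto_bandlimited_cocompact g).norm
  rw [norm_zero] at h
  have h2 := h.eventually_le_const hε
  rw [← Metric.cobounded_eq_cocompact, (Metric.hasBasis_cobounded_compl_closedBall 0).eventually_iff]
    at h2
  obtain ⟨r, -, hr⟩ := h2
  refine ⟨r, fun x hx => hr fun hxr => hx fun i => abs_le.1 ?_⟩
  exact (PiLp.norm_apply_le x i).trans (by simpa using hxr)

theorem eventually_norm_sub_mul_multiplier_le {d : ℕ} (N : ℕ) (A : ℝ) {g : L2Cube d}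
    {G : ℕ → L2Cube d} (hG : Tendsto G atTop (𝓝 g)) {Ψ : ℕ → MvPolynomial (Fin d) ℂ}
    (hΨ : ∀ ℓ, 1 ≤ ℓ → ∀ x, polyEval (Ψ ℓ) x * (cubeSineTail ℓ x : ℂ) = bandlimited (G ℓ) x)
    {δ : ℝ} (hδ : 0 < δ) :
    ∀ᶠ ℓ : ℕ in atTop, ∀ x ∈ cube d (halfSide N A ℓ),
      ‖bandlimited g x - polyEval (Ψ ℓ) x * ((multiplier N ℓ x : ℝ) : ℂ)‖ ≤ δ := by
  set C := Real.exp (d * (2 * A ^ (2 * N + 2))) with hC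
  have hC0 : 0 < C := Real.exp_pos _
  -- The first error term costs C ε. The second costs ‖g‖ ε on the fixed cube, where the ratio is
  -- near 1, and (C + 1) ε outside it, where f is small and the ratio only bounded.
  set ε := δ / (2 * C + 1 + ‖g‖) with hε
  have hM : 0 < 2 * C + 1 + ‖g‖ := by positivity
  have hε0 : 0 < ε := div_pos hδ hM
  obtain ⟨r, hr⟩ := exists_norm_bandlimited_le_off_cube g hε0
  have hG' : Tendsto (fun ℓ => ‖g - G ℓ‖) atTop (𝓝 0) := by
    simpa using (hG.const_sub g).norm
  filter_upwards [hG'.eventually_le_const hε0, eventually_ge_atTop 1, eventually_halfSide_lt N A,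
    eventually_abs_ratio_sub_one_le d N r hε0] with ℓ h1 h2 h3 h4 x hx
  refine (norm_sub_mul_multiplier_le (hΨ ℓ h2) h3 hx).trans ?_
  have h5 : C * ‖bandlimited (g - G ℓ) x‖ ≤ C * ε :=
    mul_le_mul_of_nonneg_left ((norm_bandlimited_le _ x).trans h1) hC0.le
  have h6 : ‖bandlimited g x‖ * |multiplier N ℓ x / cubeSineTail ℓ x - 1| ≤
      ε * (C + 1 + ‖g‖) := by
    by_cases hxr : x ∈ cube d r
    · calc _ ≤ ‖g‖ * ε := mul_le_mul (norm_bandlimited_le g x) (h4 x hxr) (abs_nonneg _)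
            (norm_nonneg _)
        _ ≤ _ := by nlinarith [norm_nonneg g]
    · calc _ ≤ ε * (C + 1) := mul_le_mul (hr x hxr) (abs_ratio_sub_one_le h3 hx) (abs_nonneg _)
            hε0.le
        _ ≤ _ := by nlinarith [norm_nonneg g]
  calc _ ≤ C * ε + ε * (C + 1 + ‖g‖) := add_le_add h5 h6
    _ = ε * (2 * C + 1 + ‖g‖) := by ring
    _ = δ := div_mul_cancel₀ _ hM.ne'

theorem tendsto_eLpNorm_top {d : ℕ} (N : ℕ) (A : ℝ) {g : L2Cube d}
    {G : ℕ → L2Cube d} (hG : Tendsto G atTop (𝓝 g)) {Ψ : ℕ → MvPolynomial (Fin d) ℂ}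
    (hΨ : ∀ ℓ, 1 ≤ ℓ → ∀ x, polyEval (Ψ ℓ) x * (cubeSineTail ℓ x : ℂ) = bandlimited (G ℓ) x) :
    Tendsto (fun ℓ : ℕ => eLpNorm
      (fun x : E d => bandlimited g x - polyEval (Ψ ℓ) x * ((multiplier N ℓ x : ℝ) : ℂ)) ⊤
      (volume.restrict (cube d (halfSide N A ℓ)))) atTop (𝓝 0) := by
  rw [ENNReal.tendsto_nhds_zero]
  intro ε hε
  obtain ⟨δ, hδ0, hδ⟩ := ENNReal.lt_iff_exists_nnreal_btwn.1 hε
  filter_upwards [eventually_norm_sub_mul_multiplier_le N A hG hΨ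
    (δ := δ) (by exact_mod_cast hδ0)] with ℓ h
  rw [eLpNorm_exponent_top]
  refine (eLpNormEssSup_le_of_ae_bound (C := δ) ?_).trans ?_
  · exact (ae_restrict_iff' (measurableSet_cube d _)).2 (Eventually.of_forall h)
  · rw [ENNReal.ofReal_coe_nnreal]
    exact hδ.le

theorem memLp_bandlimited {d : ℕ} (g : L2Cube d) : MemLp (bandlimited g) 2 volume := by
  obtain ⟨C, hC, h⟩ := exists_eLpNorm_bandlimited_le d
  exact ⟨(continuous_bandlimited g).aestronglyMeasurable,
    (h g).trans_lt (ENNReal.mul_lt_top hC.lt_top enorm_lt_top)⟩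

/-- Extended by zero off the moving cubes, the functions are eventually dominated by (C + 1)|f|,
which is in L_2, and tend to zero pointwise because each point lies in a fixed cube. -/
theorem tendsto_eLpNorm_mul_ratio_sub_one {d : ℕ} (N : ℕ) (A : ℝ) (g : L2Cube d) :
    Tendsto (fun ℓ : ℕ => eLpNorm
      (fun x : E d => ‖bandlimited g x‖ * |multiplier N ℓ x / cubeSineTail ℓ x - 1|) 2
      (volume.restrict (cube d (halfSide N A ℓ)))) atTop (𝓝 0) := by
  set C := Real.exp (d * (2 * A ^ (2 * N + 2))) with hC
  set F : ℕ → E d → ℝ := fun ℓ => (cube d (halfSide N A ℓ)).indicator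
    fun x => ‖bandlimited g x‖ * |multiplier N ℓ x / cubeSineTail ℓ x - 1| with hF
  have hFm : ∀ ℓ, Measurable (F ℓ) := fun ℓ => by
    refine Measurable.indicator ?_ (measurableSet_cube d _)
    have h1 := (continuous_bandlimited g).norm.measurable
    have h2 := (continuous_multiplier (d := d) N ℓ).measurable
    have h3 := (continuous_cubeSineTail (d := d) ℓ).measurable
    exact h1.mul (((h2.div h3).sub_const 1).abs)
  have hbound : ∀ᶠ ℓ in atTop, ∀ x, ‖F ℓ x‖ₑ ^ (2 : ℝ) ≤ ‖(C + 1) * ‖bandlimited g x‖‖ₑ ^ (2 : ℝ) := by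
    filter_upwards [eventually_halfSide_lt N A] with ℓ hℓ x
    refine ENNReal.rpow_le_rpow ?_ (by norm_num)
    rw [enorm_le_iff_norm_le]
    have hC1 : 0 ≤ (C + 1) * ‖bandlimited g x‖ := by positivity
    rw [Real.norm_of_nonneg hC1]
    by_cases hx : x ∈ cube d (halfSide N A ℓ)
    · rw [hF]
      dsimp only
      rw [Set.indicator_of_mem hx, Real.norm_of_nonneg (by positivity), mul_comm]
      exact mul_le_mul_of_nonneg_right (abs_ratio_sub_one_le hℓ hx) (norm_nonneg _)
    · rw [hF]
      dsimp only
      rwa [Set.indicator_of_notMem hx, norm_zero]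
  have hlim : ∀ x, Tendsto (fun ℓ => F ℓ x) atTop (𝓝 0) := by
    intro x
    rw [Metric.tendsto_nhds]
    intro ε hε
    have hM : 0 < ‖bandlimited g x‖ + 1 := by positivity
    filter_upwards [eventually_abs_ratio_sub_one_le d N ‖x‖ (div_pos hε hM)] with ℓ hℓ
    rw [dist_zero_right, hF]
    dsimp only
    by_cases hx : x ∈ cube d (halfSide N A ℓ)
    · rw [Set.indicator_of_mem hx, Real.norm_of_nonneg (by positivity)]
      calc _ ≤ ‖bandlimited g x‖ * (ε / (‖bandlimited g x‖ + 1)) :=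
            mul_le_mul_of_nonneg_left (hℓ x (mem_cube_norm x)) (norm_nonneg _)
        _ < (‖bandlimited g x‖ + 1) * (ε / (‖bandlimited g x‖ + 1)) :=
            mul_lt_mul_of_pos_right (lt_add_one _) (div_pos hε hM)
        _ = ε := mul_div_cancel₀ _ hM.ne'
    · rwa [Set.indicator_of_notMem hx, norm_zero]
  have hfin : ∫⁻ x : E d, ‖(C + 1) * ‖bandlimited g x‖‖ₑ ^ (2 : ℝ) ≠ ⊤ := by
    have h := ((memLp_bandlimited g).norm.const_mul (C + 1)).2
    rw [eLpNorm_eq_lintegral_rpow_enorm_toReal two_ne_zero ENNReal.ofNat_ne_top] at h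
    intro h'
    rw [ENNReal.toReal_ofNat, h', ENNReal.top_rpow_of_pos (by norm_num)] at h
    exact lt_irrefl _ h
  have hint := tendsto_lintegral_filter_of_dominated_convergence (μ := (volume : Measure (E d)))
    (F := fun ℓ x => ‖F ℓ x‖ₑ ^ (2 : ℝ)) (f := fun _ => 0)
    (fun x => ‖(C + 1) * ‖bandlimited g x‖‖ₑ ^ (2 : ℝ))
    (Eventually.of_forall fun ℓ => (hFm ℓ).enorm.pow_const _)
    (hbound.mono fun ℓ h => Eventually.of_forall h) hfin
    (Eventually.of_forall fun x => by
      have h := ((continuous_enorm.tendsto _).comp (hlim x)).ennrpow_const (2 : ℝ)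
      simpa using h)
  rw [lintegral_zero] at hint
  have hrt := hint.ennrpow_const (1 / 2 : ℝ)
  rw [ENNReal.zero_rpow_of_pos (by norm_num)] at hrt
  refine hrt.congr fun ℓ => ?_
  rw [← eLpNorm_indicator_eq_eLpNorm_restrict (measurableSet_cube d _),
    eLpNorm_eq_lintegral_rpow_enorm_toReal two_ne_zero ENNReal.ofNat_ne_top, ENNReal.toReal_ofNat]

/-- The weighted interpolation error is estimated over all of ℝ^d by Plancherel's bound for g - G ℓ;
the remaining term is handled by `tendsto_eLpNorm_mul_ratio_sub_one`. -/
theorem tendsto_eLpNorm_two {d : ℕ} (N : ℕ) (A : ℝ) {g : L2Cube d}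
    {G : ℕ → L2Cube d} (hG : Tendsto G atTop (𝓝 g)) {Ψ : ℕ → MvPolynomial (Fin d) ℂ}
    (hΨ : ∀ ℓ, 1 ≤ ℓ → ∀ x, polyEval (Ψ ℓ) x * (cubeSineTail ℓ x : ℂ) = bandlimited (G ℓ) x) :
    Tendsto (fun ℓ : ℕ => eLpNorm
      (fun x : E d => bandlimited g x - polyEval (Ψ ℓ) x * ((multiplier N ℓ x : ℝ) : ℂ)) 2
      (volume.restrict (cube d (halfSide N A ℓ)))) atTop (𝓝 0) := by
  set C := Real.exp (d * (2 * A ^ (2 * N + 2))) with hC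
  obtain ⟨K, hK, hKb⟩ := exists_eLpNorm_bandlimited_le d
  have hG' : Tendsto (fun ℓ => ‖C‖ₑ * (K * ‖g - G ℓ‖ₑ)) atTop (𝓝 0) := by
    have h := (continuous_enorm.tendsto _).comp (hG.const_sub g)
    rw [sub_self, enorm_zero] at h
    have h2 := ENNReal.Tendsto.const_mul (ENNReal.Tendsto.const_mul h (Or.inr hK))
      (Or.inr (enorm_ne_top (x := C)))
    simpa using h2
  have hsum := hG'.add (tendsto_eLpNorm_mul_ratio_sub_one N A g)
  rw [add_zero] at hsum
  refine tendsto_of_tendsto_of_tendsto_of_le_of_le' tendsto_const_nhds hsum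
    (Eventually.of_forall fun _ => zero_le) ?_
  filter_upwards [eventually_ge_atTop 1, eventually_halfSide_lt N A] with ℓ h1 h2
  have hm1 : Measurable fun x : E d => C * ‖bandlimited (g - G ℓ) x‖ :=
    (continuous_bandlimited _).norm.measurable.const_mul C
  have hm2 : Measurable fun x : E d =>
      ‖bandlimited g x‖ * |multiplier N ℓ x / cubeSineTail ℓ x - 1| := by
    have h1 := (continuous_bandlimited g).norm.measurable
    have h2 := (continuous_multiplier (d := d) N ℓ).measurable
    have h3 := (continuous_cubeSineTail (d := d) ℓ).measurable
    exact h1.mul (((h2.div h3).sub_const 1).abs)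
  have hmono := eLpNorm_mono_ae_real (p := 2)
    ((ae_restrict_iff' (μ := volume) (measurableSet_cube d (halfSide N A ℓ))).2
      (Eventually.of_forall fun x hx => norm_sub_mul_multiplier_le (g := g) (hΨ ℓ h1) h2 hx))
  refine hmono.trans ((eLpNorm_add_le hm1.aestronglyMeasurable hm2.aestronglyMeasurable
    one_le_two).trans (add_le_add_left ?_ _))
  calc eLpNorm (fun x : E d => C * ‖bandlimited (g - G ℓ) x‖) 2
        (volume.restrict (cube d (halfSide N A ℓ)))
      ≤ eLpNorm (fun x : E d => C * ‖bandlimited (g - G ℓ) x‖) 2 volume :=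
        eLpNorm_mono_measure _ Measure.restrict_le_self
    _ = ‖C‖ₑ * eLpNorm (bandlimited (g - G ℓ)) 2 volume := by
        rw [← eLpNorm_norm (bandlimited (g - G ℓ))]
        exact eLpNorm_const_smul C _ _ _
    _ ≤ _ := by gcongr; exact hKb _

end BandlimitedInterpolation

/-! ### Assembly of the interpolation theorem -/

open BandlimitedInterpolation in
theorem theorem5p1 (d : ℕ) (hd : 1 ≤ d) (t : (Fin d → ℤ) → E d)
    (ht : IsUniformlyInvertibleRieszBasis (fun n => expL2 d (latticePoint d n)) (indexCube d)
      (fun n => expL2 d (t n)))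
    (f : E d → ℂ) (hf : f ∈ PaleyWiener d) :
    (∀ ℓ : ℕ, 1 ≤ ℓ → ∃! p : MvPolynomial (Fin d) ℂ, IsInterpolant t f ℓ p) ∧
    ∀ Ψ : ℕ → MvPolynomial (Fin d) ℂ, (∀ ℓ : ℕ, 1 ≤ ℓ → IsInterpolant t f ℓ (Ψ ℓ)) →
      ∀ (N : ℕ) (A : ℝ), 0 < A →
        Filter.Tendsto
          (fun ℓ : ℕ => MeasureTheory.eLpNorm
            (fun x : E d => f x - polyEval (Ψ ℓ) x * ((multiplier N ℓ x : ℝ) : ℂ)) 2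
            (MeasureTheory.volume.restrict (cube d (halfSide N A ℓ))))
          Filter.atTop (nhds 0) ∧
        Filter.Tendsto
          (fun ℓ : ℕ => MeasureTheory.eLpNorm
            (fun x : E d => f x - polyEval (Ψ ℓ) x * ((multiplier N ℓ x : ℝ) : ℂ)) ⊤
            (MeasureTheory.volume.restrict (cube d (halfSide N A ℓ))))
          Filter.atTop (nhds 0) := by
  obtain ⟨g, rfl⟩ := exists_bandlimited_eq hf
  refine ⟨fun ℓ hℓ => ?_, fun Ψ hΨ N A _ => ?_⟩
  · obtain ⟨-, L, hL, M, hM⟩ := ht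
    exact existsUnique_isInterpolant (L := (L : L2Cube d →L[ℂ] L2Cube d)) hL (hM ℓ hℓ).1 _
  · obtain ⟨G, hG, hGΨ⟩ := exists_tendsto_spectrum ht g hΨ
    exact ⟨tendsto_eLpNorm_two N A hG hGΨ, tendsto_eLpNorm_top N A hG hGΨ⟩
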